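/- Let $\varphi$ be a propositional formula in negation normal form, i.e. built with $\wedge$ and $\vee$ from the literals $x_i,\neg x_i$ and the constants $0,1$. An interpretation over the Viterbi semiring $\mathbb V=([0,1],\max,\cdot,0,1)$ is a map $\pi$ from the variables to $[0,1]$, and the confidence of a formula is defined by $\mathsf{Conf}(0,\pi)=0$, $\mathsf{Conf}(1,\pi)=1$, $\mathsf{Conf}(x,\pi)=\pi(x)$, $\mathsf{Conf}(\neg x,\pi)=1-\pi(x)$, $\mathsf{Conf}(\alpha\vee\beta,\pi)=\max(\mathsf{Conf}(\alpha,\pi),\mathsf{Conf}(\beta,\pi))$ and $\mathsf{Conf}(\alpha\wedge\beta,\pi)=\mathsf{Conf}(\alpha,\pi)\cdot\mathsf{Conf}(\beta,\pi)$. Let $\mathsf{optConfVal}(\varphi)=\max_\pi \mathsf{Conf}(\varphi,\pi)$. **Theorem.** For every formula $\varphi$ in negation normal form the maximum $\mathsf{optConfVal}(\varphi)$ is attained and is a rational number, and its denominator in lowest terms is at most $2^{nm\log_2 m}=m^{nm}$ (read as $1$ if $m=0$), where $n$ is the number of variables occurring in $\varphi$ and $m$ is the total number of occurrences of variables and negated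 variables in $\varphi$. Moreover, the function $\varphi\mapsto\mathsf{optConfVal}(\varphi)$ is in $\mathrm{FP}^{\mathrm{NP}}$: there are a language $A\in\mathrm{NP}$ and a deterministic polynomial-time machine with oracle $A$ that, given $\varphi$ (as a bit string, in prefix notation with variable indices in binary), outputs the numerator and the denominator of $\mathsf{optConfVal}(\varphi)$ in lowest terms, in binary. -/

import Mathlib

namespace ConfOpt

/-! ### Formulas in negation normal form and their semantics over a semiring -/

/-- Propositional formulas in negation normal form over the variables `x_0, x_1, x_2, …`:
`lit true i` is the literal `x_i`, `lit false i` is the literal `¬ x_i`, and the leaves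
`const true`, `const false` are the constants 1 and 0. -/
inductive NNF : Type
  | const (b : Bool) : NNF
  | lit (positive : Bool) (i : ℕ) : NNF
  | and (φ ψ : NNF) : NNF
  | or (φ ψ : NNF) : NNF

/-- The variables that occur in a formula. -/
def NNF.vars : NNF → Finset ℕ
  | .const _ => ∅
  | .lit _ i => {i}
  | .and φ ψ => φ.vars ∪ ψ.vars
  | .or φ ψ => φ.vars ∪ ψ.vars

/-- The size of a formula: the total number of occurrences of variables and negated variables. -/
def NNF.size : NNF → ℕ
  | .const _ => 0
  | .lit _ _ => 1
  | .and φ ψ => φ.size + ψ.size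
  | .or φ ψ => φ.size + ψ.size

/-- The semantics of a formula over a semiring `K` with negation function `neg`, under the
interpretation `π` of the variables. -/
def Sem {K : Type*} [Semiring K] (neg : K → K) (φ : NNF) (π : ℕ → K) : K :=
  match φ with
  | .const true => 1
  | .const false => 0
  | .lit true i => π i
  | .lit false i => neg (π i)
  | .and α β => Sem neg α π * Sem neg β π
  | .or α β => Sem neg α π + Sem neg β π

/-- `v` is the maximum of `Sem neg φ π` over all interpretations `π`. -/
def IsOptSemVal {K : Type*} [Semiring K] [LinearOrder K] (neg : K → K) (φ : NNF) (v : K) : Prop :=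
  IsGreatest (Set.range fun π : ℕ → K => Sem neg φ π) v

/-! ### The Viterbi semiring `([0,1], max, ·, 0, 1)` -/

/-- The underlying set of the Viterbi semiring, the real unit interval. -/
def Viterbi : Type := ↥unitInterval

/-- The real number that an element of the Viterbi semiring is. -/
def Viterbi.val (x : Viterbi) : ℝ := Subtype.val x

noncomputable instance : LinearOrder Viterbi := inferInstanceAs (LinearOrder ↥unitInterval)

noncomputable instance : CommMonoidWithZero Viterbi :=
  inferInstanceAs (CommMonoidWithZero ↥unitInterval)

theorem Viterbi.zero_le (a : Viterbi) : (0 : Viterbi) ≤ a := a.2.1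

theorem Viterbi.mul_max (a b c : Viterbi) : a * max b c = max (a * b) (a * c) := by
  have h : Monotone fun x : Viterbi => a * x := fun x y hxy =>
    Subtype.coe_le_coe.1 (mul_le_mul_of_nonneg_left (Subtype.coe_le_coe.2 hxy) a.2.1)
  exact h.map_max

/-- Addition in the Viterbi semiring is the maximum. -/
noncomputable instance : Add Viterbi := ⟨fun a b => max a b⟩

noncomputable instance : CommSemiring Viterbi :=
  { (inferInstance : CommMonoidWithZero Viterbi) with
    add_assoc := max_assoc
    zero_add := fun a => max_eq_right (Viterbi.zero_le a)
    add_zero := fun a => max_eq_left (Viterbi.zero_le a)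
    add_comm := max_comm
    left_distrib := Viterbi.mul_max
    right_distrib := fun a b c => by
      change max a b * c = max (a * c) (b * c)
      rw [mul_comm, Viterbi.mul_max, mul_comm c a, mul_comm c b]
    nsmul := nsmulRec }

/-- The negation function `x ↦ 1 - x`. -/
def Viterbi.neg (x : Viterbi) : Viterbi := unitInterval.symm x

/-- The confidence of a formula: its semantics over the Viterbi semiring. -/
noncomputable def Conf (φ : NNF) (π : ℕ → Viterbi) : Viterbi := Sem Viterbi.neg φ π

/-- `v` is the value `optConfVal(φ)`, the maximum of `Conf φ π` over all interpretations `π`. -/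
def IsOptConfVal (φ : NNF) (v : Viterbi) : Prop := IsOptSemVal Viterbi.neg φ v

/-! ### Binary encodings -/

/-- Self-delimiting binary encoding of a natural number: each binary digit `b`, from the least
significant one on, is written as `1 b`, and a final `0` ends the number. -/
def encodeNat (k : ℕ) : List Bool := (k.bits.flatMap fun b => [true, b]) ++ [false]

/-- Encoding of formulas: prefix notation, with variable indices in binary. -/
def encodeNNF : NNF → List Bool
  | .const b => [false, false, b]
  | .lit p i => true :: p :: encodeNat i
  | .and φ ψ => false :: true :: false :: (encodeNNF φ ++ encodeNNF ψ)
  | .or φ ψ => false :: true :: true :: (encodeNNF φ ++ encodeNNF ψ)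

/-- Encoding of a nonnegative rational: numerator and denominator, in lowest terms, in binary. -/
def encodeNNRat (q : ℚ≥0) : List Bool := encodeNat q.num ++ encodeNat q.den

/-! ### Oracle machines with a running time

The machine model is the random access machine with addition, subtraction and halving of natural
numbers, under the logarithmic cost criterion (an instruction costs one plus the total number of
binary digits of its operands), written as a structured program. There is no multiplication, so that
an instruction makes a number longer by at most one digit; up to a polynomial, the cost is the running
time of a Turing machine. -/

/-- Programs. Registers are numbered by natural numbers (a program uses finitely many) and hold
natural numbers. -/
inductive Prog : Type
  /-- do nothing -/
  | skip : Prog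
  /-- `r := c` -/
  | const (r c : ℕ) : Prog
  /-- `r := s` -/
  | copy (r s : ℕ) : Prog
  /-- `r := s + t` -/
  | add (r s t : ℕ) : Prog
  /-- `r := max (s - t) 0` -/
  | sub (r s t : ℕ) : Prog
  /-- `r := ⌊s / 2⌋` -/
  | half (r s : ℕ) : Prog
  /-- ask the oracle about the string in `s`; `r := 1` if the answer is yes, `r := 0` otherwise -/
  | query (r s : ℕ) : Prog
  /-- first `P`, then `Q` -/
  | seq (P Q : Prog) : Prog
  /-- if `r ≠ 0` then `P` else `Q` -/
  | ite (r : ℕ) (P Q : Prog) : Prog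
  /-- while `r ≠ 0` do `P` -/
  | loop (r : ℕ) (P : Prog) : Prog

/-- The contents of the registers. -/
abbrev Regs : Type := ℕ → ℕ

/-- A bit string as the contents of a register: the string `b_0 b_1 … b_{l-1}` is the number
`b_0 + 2 b_1 + … + 2^{l-1} b_{l-1} + 2^l`. This is a bijection onto the positive numbers. -/
def strCode : List Bool → ℕ
  | [] => 1
  | b :: w => Nat.bit b (strCode w)

open Classical in
/-- The oracle's answer to the string with code `x`. -/
noncomputable def oracleAnswer (A : Language Bool) (x : ℕ) : ℕ :=
  if ∃ w ∈ A, strCode w = x then 1 else 0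

/-- `Exec A P s c s'`: with oracle `A`, the program `P`, started with register contents `s`, halts with
register contents `s'` after a computation of cost `c`. `Nat.size x` is the number of binary digits
of `x`. -/
inductive Exec (A : Language Bool) : Prog → Regs → ℕ → Regs → Prop
  | skip (s : Regs) : Exec A .skip s 1 s
  | const (r k : ℕ) (s : Regs) :
      Exec A (.const r k) s (1 + k.size) (Function.update s r k)
  | copy (r i : ℕ) (s : Regs) :
      Exec A (.copy r i) s (1 + (s i).size) (Function.update s r (s i))
  | add (r i j : ℕ) (s : Regs) :
      Exec A (.add r i j) s (1 + (s i).size + (s j).size) (Function.update s r (s i + s j))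
  | sub (r i j : ℕ) (s : Regs) :
      Exec A (.sub r i j) s (1 + (s i).size + (s j).size) (Function.update s r (s i - s j))
  | half (r i : ℕ) (s : Regs) :
      Exec A (.half r i) s (1 + (s i).size) (Function.update s r (s i / 2))
  | query (r i : ℕ) (s : Regs) :
      Exec A (.query r i) s (1 + (s i).size) (Function.update s r (oracleAnswer A (s i)))
  | seq {P Q : Prog} {s s' s'' : Regs} {c d : ℕ}
      (hP : Exec A P s c s') (hQ : Exec A Q s' d s'') : Exec A (.seq P Q) s (c + d) s''
  | ite_true {r : ℕ} {P Q : Prog} {s s' : Regs} {c : ℕ}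
      (hr : s r ≠ 0) (hP : Exec A P s c s') : Exec A (.ite r P Q) s (1 + (s r).size + c) s'
  | ite_false {r : ℕ} {P Q : Prog} {s s' : Regs} {c : ℕ}
      (hr : s r = 0) (hQ : Exec A Q s c s') : Exec A (.ite r P Q) s (1 + (s r).size + c) s'
  | loop_step {r : ℕ} {P : Prog} {s s' s'' : Regs} {c d : ℕ}
      (hr : s r ≠ 0) (hP : Exec A P s c s') (hloop : Exec A (.loop r P) s' d s'') :
      Exec A (.loop r P) s (1 + (s r).size + c + d) s''
  | loop_done {r : ℕ} {P : Prog} {s : Regs}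
      (hr : s r = 0) : Exec A (.loop r P) s (1 + (s r).size) s

/-- Initial register contents: `x` in register 0, `y` in register 1, and 0 in all others. -/
def initRegs (x y : ℕ) : Regs := fun r => if r = 0 then x else if r = 1 then y else 0

/-! ### The classes NP and FP^NP -/

/-- `L` is in NP: for a polynomial `p` and a deterministic polynomial-time verifier `V`, without oracle
(that is, with the empty oracle `0 : Language Bool`), a string `x` is in `L` iff `V` accepts `(x, y)`
for some certificate `y` of length at most `p(|x|)`; to accept is to halt with 1 in register 0. -/
def InNP (L : Language Bool) : Prop :=
  ∃ (p q : Polynomial ℕ) (V : Prog),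
    (∀ x y : List Bool, ∃ (c : ℕ) (s : Regs),
      Exec 0 V (initRegs (strCode x) (strCode y)) c s ∧ c ≤ q.eval (x.length + y.length)) ∧
    ∀ x : List Bool, x ∈ L ↔
      ∃ y : List Bool, y.length ≤ p.eval x.length ∧
        ∃ (c : ℕ) (s : Regs), Exec 0 V (initRegs (strCode x) (strCode y)) c s ∧ s 0 = 1

/-- `f` is in FP^NP: it is computed in polynomial time by a program with an oracle in NP. -/
def InFPNP (f : List Bool → List Bool) : Prop :=
  ∃ (A : Language Bool) (q : Polynomial ℕ) (P : Prog), InNP A ∧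
    ∀ x : List Bool, ∃ (c : ℕ) (s : Regs),
      Exec A P (initRegs (strCode x) 0) c s ∧ c ≤ q.eval x.length ∧ s 0 = strCode (f x)

end ConfOpt

namespace ConfOpt

/-! Products of nonnegative numbers distribute over maxima, so the confidence of `φ` is the maximum,
over all ways of selecting one disjunct at each disjunction reached, of the product of the selected
leaves. Both maxima may be exchanged, and it remains to optimise a single conjunction of leaves. If
it contains the constant 0, its value is 0. Otherwise a variable with `b` positive and `a` negative
occurrences contributes p^b (1-p)^a, which is greatest at p = b/(a+b), with value a^a b^b /
(a+b)^(a+b). So the optimum is attained and rational, with denominator at most m^m ≤ m^(nm).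
Attainment is `prod_optInterp`. The upper bound `prod_leafVal_le` uses x ≤ exp(x-1) for the ratios
to the optimal factors, whose sum is controlled by `sum_ratio_le`. `exists_conf_ge` and
`exists_choices_ge` carry both over to formulas. For the complexity bound, all selections share the
denominator M!^M (`commonDen`, `prod_leafDen_dvd`), where M is about the input length, so it has
polynomially many digits. A selection is an NP certificate for "the optimum is at least z / M!^M".
Binary search with this oracle finds the numerator exactly (`optUnits_spec`), and a gcd reduces the
fraction. Running times are handled by the class `PT`, which is closed under composition, pairing,
branching and loops with as many rounds as a number has digits. Selections are evaluated by reading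
the encoded formula from left to right with a stack of bits (`run_formula`). -/

/-! ### Running programs -/

/-- The program with all registers shifted by `d`. -/
def Prog.shift (d : ℕ) : Prog → Prog
  | .skip => .skip
  | .const r c => .const (d + r) c
  | .copy r i => .copy (d + r) (d + i)
  | .add r i j => .add (d + r) (d + i) (d + j)
  | .sub r i j => .sub (d + r) (d + i) (d + j)
  | .half r i => .half (d + r) (d + i)
  | .query r i => .query (d + r) (d + i)
  | .seq P Q => .seq (P.shift d) (Q.shift d)
  | .ite r P Q => .ite (d + r) (P.shift d) (Q.shift d)
  | .loop r P => .loop (d + r) (P.shift d)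

theorem update_shift {d r v : ℕ} {s t : Regs} (h : ∀ i, t (d + i) = s i) :
    (∀ i, Function.update t (d + r) v (d + i) = Function.update s r v i) ∧
      ∀ i < d, Function.update t (d + r) v i = t i := by
  refine ⟨fun i => ?_, fun i hi => ?_⟩
  · by_cases hir : i = r
    · subst hir; simp
    · rw [Function.update_of_ne (by omega), Function.update_of_ne hir, h]
  · rw [Function.update_of_ne (by omega)]

/-- Relocation lets a program work above registers that must survive: nothing below `d` changes, and
the cost is the same. -/
theorem Exec.shift {A : Language Bool} {P : Prog} {s s' : Regs} {c : ℕ} (d : ℕ)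
    (h : Exec A P s c s') (t : Regs) (ht : ∀ i, t (d + i) = s i) :
    ∃ t', Exec A (P.shift d) t c t' ∧ (∀ i, t' (d + i) = s' i) ∧ ∀ i < d, t' i = t i := by
  induction h generalizing t with
  | skip s => exact ⟨t, .skip t, ht, fun _ _ => rfl⟩
  | const r k s => exact ⟨_, .const _ _ _, update_shift ht⟩
  | copy r i s => rw [← ht i]; exact ⟨_, .copy _ _ _, update_shift ht⟩
  | add r i j s => rw [← ht i, ← ht j]; exact ⟨_, .add _ _ _ _, update_shift ht⟩
  | sub r i j s => rw [← ht i, ← ht j]; exact ⟨_, .sub _ _ _ _, update_shift ht⟩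
  | half r i s => rw [← ht i]; exact ⟨_, .half _ _ _, update_shift ht⟩
  | query r i s => rw [← ht i]; exact ⟨_, .query _ _ _, update_shift ht⟩
  | seq _ _ ihP ihQ =>
    obtain ⟨t₁, e₁, h₁, l₁⟩ := ihP t ht
    obtain ⟨t₂, e₂, h₂, l₂⟩ := ihQ t₁ h₁
    exact ⟨t₂, .seq e₁ e₂, h₂, fun i hi => (l₂ i hi).trans (l₁ i hi)⟩
  | ite_true hr _ ih =>
    obtain ⟨t₁, e₁, h₁⟩ := ih t ht
    rw [← ht] at hr ⊢
    exact ⟨t₁, .ite_true hr e₁, h₁⟩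
  | ite_false hr _ ih =>
    obtain ⟨t₁, e₁, h₁⟩ := ih t ht
    rw [← ht] at hr ⊢
    exact ⟨t₁, .ite_false hr e₁, h₁⟩
  | loop_step hr _ _ ihP ihQ =>
    obtain ⟨t₁, e₁, h₁, l₁⟩ := ihP t ht
    obtain ⟨t₂, e₂, h₂, l₂⟩ := ihQ t₁ h₁
    rw [← ht] at hr ⊢
    exact ⟨t₂, .loop_step hr e₁ e₂, h₂, fun i hi => (l₂ i hi).trans (l₁ i hi)⟩
  | loop_done hr =>
    rw [← ht] at hr ⊢
    exact ⟨t, .loop_done hr, ht, fun _ _ => rfl⟩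

/-- Acceptance by a verifier only asserts that some run ends with 1; determinism identifies it with
the run whose result is known. -/
theorem Exec.det {A : Language Bool} {P : Prog} {s s₁ s₂ : Regs} {c₁ c₂ : ℕ}
    (h₁ : Exec A P s c₁ s₁) (h₂ : Exec A P s c₂ s₂) : s₁ = s₂ := by
  induction h₁ generalizing c₂ s₂ with
  | seq _ _ ihP ihQ =>
    cases h₂ with
    | seq hP hQ => exact ihQ (ihP hP ▸ hQ)
  | ite_true hr _ ih =>
    cases h₂ with
    | ite_true _ hP => exact ih hP
    | ite_false hr' _ => exact absurd hr' hr
  | ite_false hr _ ih =>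
    cases h₂ with
    | ite_true hr' _ => exact absurd hr hr'
    | ite_false _ hP => exact ih hP
  | loop_step hr _ _ ihP ihQ =>
    cases h₂ with
    | loop_step _ hP hQ => exact ihQ (ihP hP ▸ hQ)
    | loop_done hr' => exact absurd hr' hr
  | loop_done hr =>
    cases h₂ with
    | loop_step hr' _ _ => exact absurd hr hr'
    | loop_done _ => rfl
  | _ => cases h₂; rfl

/-- Copy the `n` registers from `src` on to the `n` registers from `dst` on. -/
def copyBlock (dst src : ℕ) : ℕ → Prog
  | 0 => .skip
  | n + 1 => .seq (copyBlock dst src n) (.copy (dst + n) (src + n))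

/-- Copying in ascending order is safe for overlapping blocks as long as the destination is not
above the source. -/
theorem exec_copyBlock (A : Language Bool) {dst src n B : ℕ} (s : Regs)
    (hd : dst ≤ src ∨ src + n ≤ dst) (hB : ∀ i < n, (s (src + i)).size ≤ B) :
    ∃ c s', Exec A (copyBlock dst src n) s c s' ∧ c ≤ 1 + n * (1 + B) ∧
      (∀ i < n, s' (dst + i) = s (src + i)) ∧
      ∀ j, (j < dst ∨ dst + n ≤ j) → s' j = s j := by
  induction n with
  | zero => exact ⟨1, s, .skip s, by simp, by simp, fun _ _ => rfl⟩
  | succ n ih =>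
    obtain ⟨c, s', e, hc, h₁, h₂⟩ := ih (by omega) fun i hi => hB i (by omega)
    have hs : s' (src + n) = s (src + n) := h₂ _ (by omega)
    refine ⟨_, _, .seq e (.copy _ _ _), ?_, fun i hi => ?_, fun j hj => ?_⟩
    · have := hB n (by omega)
      rw [hs]; nlinarith
    · by_cases hin : i = n
      · subst hin; simp [hs]
      · rw [Function.update_of_ne (by omega), h₁ i (by omega)]
    · rw [Function.update_of_ne (by omega), h₂ j (by omega)]

/-- Put the first `n` values of `v` into the first `n` registers. -/
def constBlock (v : ℕ → ℕ) : ℕ → Prog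
  | 0 => .skip
  | n + 1 => .seq (constBlock v n) (.const n (v n))

theorem exec_constBlock (A : Language Bool) (v : ℕ → ℕ) (n : ℕ) :
    ∃ B, ∀ s : Regs, ∃ c s', Exec A (constBlock v n) s c s' ∧ c ≤ B ∧ ∀ i < n, s' i = v i := by
  induction n with
  | zero => exact ⟨1, fun s => ⟨1, s, .skip s, le_rfl, by simp⟩⟩
  | succ n ih =>
    obtain ⟨B, ih⟩ := ih
    refine ⟨B + (1 + (v n).size), fun s => ?_⟩
    obtain ⟨c, s', e, hc, h⟩ := ih s
    refine ⟨_, _, .seq e (.const _ _ _), by omega, fun i hi => ?_⟩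
    by_cases hin : i = n
    · subst hin; simp
    · rw [Function.update_of_ne hin, h i (by omega)]

/-! ### Polynomial time functions -/

/-- Data that is stored in a block of registers. -/
class RegEnc (α : Type) where
  /-- the number of registers -/
  width : ℕ
  /-- the contents of the registers -/
  enc : α → ℕ → ℕ

instance : RegEnc ℕ := ⟨1, fun n _ => n⟩

instance {α β : Type} [RegEnc α] [RegEnc β] : RegEnc (α × β) :=
  ⟨RegEnc.width α + RegEnc.width β, fun p i =>
    if i < RegEnc.width α then RegEnc.enc p.1 i else RegEnc.enc p.2 (i - RegEnc.width α)⟩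

section

variable {α β γ σ : Type} [RegEnc α] [RegEnc β] [RegEnc γ] [RegEnc σ]

/-- The registers from `d` on hold `a`. -/
def Holds (s : Regs) (d : ℕ) (a : α) : Prop :=
  ∀ i < RegEnc.width α, s (d + i) = RegEnc.enc a i

/-- The maximal length of a register of `a`. -/
def mx (a : α) : ℕ := (Finset.range (RegEnc.width α)).sup fun i => (RegEnc.enc a i).size

theorem size_enc_le (a : α) {i : ℕ} (hi : i < RegEnc.width α) : (RegEnc.enc a i).size ≤ mx a :=
  Finset.le_sup (f := fun i => (RegEnc.enc a i).size) (Finset.mem_range.2 hi)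

@[simp] theorem mx_nat (n : ℕ) : mx n = n.size := by
  simp [mx, RegEnc.width, RegEnc.enc]

theorem holds_prod {s : Regs} {d : ℕ} {p : α × β} :
    Holds s d p ↔ Holds s d p.1 ∧ Holds s (d + RegEnc.width α) p.2 := by
  constructor
  · refine fun h => ⟨fun i hi => ?_, fun i hi => ?_⟩
    · rw [h i (Nat.lt_add_right _ hi)]; exact if_pos hi
    · rw [add_assoc, h _ (Nat.add_lt_add_left hi _)]
      change (if _ then _ else _) = _
      rw [if_neg (by omega), Nat.add_sub_cancel_left]
  · rintro ⟨h₁, h₂⟩ i hi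
    change i < RegEnc.width α + RegEnc.width β at hi
    change _ = if _ then _ else _
    split_ifs with h
    · exact h₁ i h
    · rw [← h₂ _ (by omega)]; congr 1; omega

@[simp] theorem mx_prod (p : α × β) : mx p = max (mx p.1) (mx p.2) := by
  apply le_antisymm
  · refine Finset.sup_le fun i hi => ?_
    rw [Finset.mem_range] at hi
    change i < RegEnc.width α + RegEnc.width β at hi
    change Nat.size (if _ then _ else _) ≤ _
    split_ifs with h
    · exact (size_enc_le _ h).trans (le_max_left _ _)
    · exact (size_enc_le _ (by omega)).trans (le_max_right _ _)
  · refine max_le (Finset.sup_le fun i hi => ?_) (Finset.sup_le fun i hi => ?_)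
    · rw [Finset.mem_range] at hi
      have := size_enc_le p (i := i) (Nat.lt_add_right _ hi)
      change Nat.size (if _ then _ else _) ≤ _ at this
      rwa [if_pos hi] at this
    · rw [Finset.mem_range] at hi
      have := size_enc_le p (i := RegEnc.width α + i) (Nat.add_lt_add_left hi _)
      change Nat.size (if _ then _ else _) ≤ _ at this
      rwa [if_neg (by omega), Nat.add_sub_cancel_left] at this

theorem eval_mono (q : Polynomial ℕ) : Monotone fun n => q.eval n := by
  intro a b h
  simp only [Polynomial.eval_eq_sum_range]
  gcongr

/-- The program `P` computes `f` in place with cost bounded by the polynomial `q`. -/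
def Computes (A : Language Bool) (P : Prog) (q : Polynomial ℕ) (f : α → β) : Prop :=
  ∀ (a : α) (s : Regs), Holds s 0 a →
    ∃ c s', Exec A P s c s' ∧ c ≤ q.eval (mx a) ∧ Holds s' 0 (f a)

/-- The function `f` is computable in polynomial time with oracle `A`. -/
@[fun_prop]
def PT (A : Language Bool) (f : α → β) : Prop :=
  -- The bound on the length of the output is part of the notion so that costs can be composed.
  (∃ P q, Computes A P q f) ∧ ∃ q : Polynomial ℕ, ∀ a, mx (f a) ≤ q.eval (mx a)

variable {A : Language Bool}

theorem Computes.shift {P : Prog} {q : Polynomial ℕ} {f : α → β} (h : Computes A P q f) {d : ℕ}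
    {a : α} {s : Regs} (hs : Holds s d a) :
    ∃ c s', Exec A (P.shift d) s c s' ∧ c ≤ q.eval (mx a) ∧ Holds s' d (f a) ∧
      ∀ i < d, s' i = s i := by
  obtain ⟨c, s', e, hc, h'⟩ := h a (fun i => s (d + i)) fun i hi => by simpa using hs i hi
  obtain ⟨t, et, ht, hl⟩ := e.shift d s fun _ => rfl
  exact ⟨c, t, et, hc, fun i hi => by rw [ht, ← h' i hi, zero_add], hl⟩

theorem exec_copy_holds {src dst : ℕ} {a : α} {s : Regs} (hs : Holds s src a)
    (hd : dst ≤ src ∨ src + RegEnc.width α ≤ dst) :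
    ∃ c s', Exec A (copyBlock dst src (RegEnc.width α)) s c s' ∧
      c ≤ 1 + RegEnc.width α * (1 + mx a) ∧ Holds s' dst a ∧
      ∀ j, (j < dst ∨ dst + RegEnc.width α ≤ j) → s' j = s j := by
  obtain ⟨c, s', e, hc, h₁, h₂⟩ := exec_copyBlock A (B := mx a) s hd fun i hi => by
    rw [hs i hi]; exact size_enc_le a hi
  exact ⟨c, s', e, hc, fun i hi => by rw [h₁ i hi, hs i hi], h₂⟩

theorem Holds.congr {d : ℕ} {a : α} {s s' : Regs} (h : Holds s d a)
    (hs : ∀ i, d ≤ i → i < d + RegEnc.width α → s' i = s i) : Holds s' d a :=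
  fun i hi => by rw [hs _ (by omega) (by omega), h i hi]

@[fun_prop]
theorem PT.id : PT A fun a : α => a :=
  ⟨⟨.skip, 1, fun a s hs => ⟨1, s, .skip s, by simp, hs⟩⟩, Polynomial.X, fun a => by simp⟩

@[fun_prop]
theorem PT.const (b : β) : PT A fun _ : α => b := by
  obtain ⟨B, hB⟩ := exec_constBlock A (RegEnc.enc b) (RegEnc.width β)
  refine ⟨⟨constBlock (RegEnc.enc b) (RegEnc.width β), Polynomial.C B, fun a s _ => ?_⟩,
    Polynomial.C (mx b), fun a => by simp⟩
  obtain ⟨c, s', e, hc, h⟩ := hB s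
  exact ⟨c, s', e, by simpa using hc, fun i hi => by simpa using h i hi⟩

@[fun_prop]
theorem PT.comp {g : β → γ} {f : α → β} (hg : PT A g) (hf : PT A f) : PT A fun a => g (f a) := by
  obtain ⟨⟨P, q, hP⟩, r, hr⟩ := hf
  obtain ⟨⟨P', q', hP'⟩, r', hr'⟩ := hg
  refine ⟨⟨.seq P P', q + q'.comp r, fun a s hs => ?_⟩, r'.comp r, fun a => ?_⟩
  · obtain ⟨c, s', e, hc, h⟩ := hP a s hs
    obtain ⟨c', s'', e', hc', h'⟩ := hP' _ s' h
    refine ⟨_, _, .seq e e', ?_, h'⟩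
    rw [Polynomial.eval_add, Polynomial.eval_comp]
    exact add_le_add hc (hc'.trans (eval_mono q' (hr a)))
  · rw [Polynomial.eval_comp]
    exact (hr' _).trans (eval_mono r' (hr a))

-- A program may destroy its input. So `f` runs on a copy of `a` placed above the original, `g` on a
-- second copy placed above the result of `f`; the two adjacent results are then moved down.
@[fun_prop]
theorem PT.pair {f : α → β} {g : α → γ} (hf : PT A f) (hg : PT A g) :
    PT A fun a => (f a, g a) := by
  obtain ⟨⟨P, q, hP⟩, r, hr⟩ := hf
  obtain ⟨⟨P', q', hP'⟩, r', hr'⟩ := hg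
  let w := RegEnc.width α
  let w' := RegEnc.width β
  let w'' := RegEnc.width γ
  refine ⟨⟨.seq (copyBlock w 0 w) (.seq (P.shift w) (.seq (copyBlock (w + w') 0 w)
      (.seq (P'.shift (w + w')) (copyBlock 0 w (w' + w''))))),
      (1 + (w : Polynomial ℕ) * (1 + .X)) + (q + ((1 + (w : Polynomial ℕ) * (1 + .X)) +
        (q' + (1 + ((w' + w'' : ℕ) : Polynomial ℕ) * (1 + (r + r')))))), fun a s hs => ?_⟩,
    r + r', fun a => ?_⟩
  · obtain ⟨c₁, s₁, e₁, hc₁, h₁, l₁⟩ := exec_copy_holds (A := A) (dst := w) hs (by simp [w])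
    obtain ⟨c₂, s₂, e₂, hc₂, h₂, l₂⟩ := hP.shift h₁
    have hs₂ : Holds s₂ 0 a := hs.congr fun i _ hi => by
      rw [l₂ i (by omega), l₁ i (by omega)]
    obtain ⟨c₃, s₃, e₃, hc₃, h₃, l₃⟩ := exec_copy_holds (A := A) (dst := w + w') hs₂
      (by right; omega)
    have h₃' : Holds s₃ w (f a) := h₂.congr fun i _ hi => l₃ i (by omega)
    obtain ⟨c₄, s₄, e₄, hc₄, h₄, l₄⟩ := hP'.shift h₃
    have h₄' : Holds s₄ w (f a) := h₃'.congr fun i _ hi => l₄ i (by omega)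
    have h₄'' : Holds s₄ w (f a, g a) := holds_prod.2 ⟨h₄', h₄⟩
    obtain ⟨c₅, s₅, e₅, hc₅, h₅, l₅⟩ := exec_copy_holds (A := A) (dst := 0) h₄'' (by simp)
    refine ⟨_, _, .seq e₁ (.seq e₂ (.seq e₃ (.seq e₄ e₅))), ?_, h₅⟩
    simp only [Polynomial.eval_add, Polynomial.eval_mul, Polynomial.eval_one,
      Polynomial.eval_natCast, Polynomial.eval_X]
    refine add_le_add hc₁ (add_le_add hc₂ (add_le_add hc₃ (add_le_add hc₄ (hc₅.trans ?_))))
    rw [mx_prod]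
    have := hr a
    have := hr' a
    exact Nat.add_le_add_left (Nat.mul_le_mul le_rfl (by simp only; omega)) _
  · rw [mx_prod, Polynomial.eval_add]
    have := hr a
    have := hr' a
    simp only
    omega

@[fun_prop]
theorem PT.fst : PT A (Prod.fst : α × β → α) :=
  ⟨⟨.skip, 1, fun a s hs => ⟨1, s, .skip s, by simp, (holds_prod.1 hs).1⟩⟩, Polynomial.X,
    fun a => by simp⟩

@[fun_prop]
theorem PT.snd : PT A (Prod.snd : α × β → β) := by
  refine ⟨⟨copyBlock 0 (RegEnc.width α) (RegEnc.width β),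
    1 + (RegEnc.width β : Polynomial ℕ) * (1 + .X), fun a s hs => ?_⟩, Polynomial.X,
    fun a => by simp⟩
  have h := (holds_prod.1 hs).2
  rw [zero_add] at h
  obtain ⟨c, s', e, hc, h', _⟩ := exec_copy_holds (A := A) (dst := 0) h (by simp)
  refine ⟨c, s', e, hc.trans ?_, h'⟩
  simp only [Polynomial.eval_add, Polynomial.eval_mul, Polynomial.eval_one,
      Polynomial.eval_natCast, Polynomial.eval_X, mx_prod]
  exact Nat.add_le_add_left (Nat.mul_le_mul le_rfl (Nat.add_le_add_left (le_max_right _ _) _)) _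

theorem holds_nat {s : Regs} {d n : ℕ} : Holds s d n ↔ s d = n := by
  simp [Holds, RegEnc.width, RegEnc.enc]

theorem holds_nat_prod {s : Regs} {d : ℕ} {p : ℕ × α} :
    Holds s d p ↔ s d = p.1 ∧ Holds s (d + 1) p.2 := by
  rw [holds_prod, holds_nat]; rfl

theorem size_add_le (a b : ℕ) : (a + b).size ≤ max a.size b.size + 1 := by
  rw [Nat.size_le, pow_succ]
  have h₁ : a < 2 ^ max a.size b.size :=
    (Nat.lt_size_self a).trans_le (Nat.pow_le_pow_right (by norm_num) (le_max_left _ _))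
  have h₂ : b < 2 ^ max a.size b.size :=
    (Nat.lt_size_self b).trans_le (Nat.pow_le_pow_right (by norm_num) (le_max_right _ _))
  omega

theorem size_mul_le (a b : ℕ) : (a * b).size ≤ a.size + b.size := by
  rw [Nat.size_le, pow_add]
  exact Nat.mul_lt_mul'' (Nat.lt_size_self a) (Nat.lt_size_self b)

theorem size_self_le (n : ℕ) : n.size ≤ n := Nat.size_le.2 Nat.lt_two_pow_self

theorem size_half (n : ℕ) : (n / 2).size = n.size - 1 := by
  rcases Nat.eq_zero_or_pos n with rfl | h
  · simp
  · obtain ⟨b, m, rfl⟩ : ∃ b m, n = Nat.bit b m := ⟨n.bodd, n.div2, (Nat.bit_bodd_div2 n).symm⟩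
    rw [Nat.size_bit (by omega), Nat.bit_div_two]
    rfl

/-! ### Instructions, branching and bounded loops -/

theorem PT.add_aux : PT A fun p : ℕ × ℕ => p.1 + p.2 := by
  refine ⟨⟨.add 0 0 1, 1 + 2 * .X, fun a s hs => ?_⟩, .X + 1, fun a => ?_⟩
  · obtain ⟨h₁, h₂⟩ := holds_nat_prod.1 hs
    rw [holds_nat] at h₂
    refine ⟨_, _, .add 0 0 1 s, ?_, holds_nat.2 (by simp_all)⟩
    simp_all
    omega
  · simpa using size_add_le a.1 a.2

theorem PT.sub_aux : PT A fun p : ℕ × ℕ => p.1 - p.2 := by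
  refine ⟨⟨.sub 0 0 1, 1 + 2 * .X, fun a s hs => ?_⟩, .X, fun a => ?_⟩
  · obtain ⟨h₁, h₂⟩ := holds_nat_prod.1 hs
    rw [holds_nat] at h₂
    refine ⟨_, _, .sub 0 0 1 s, ?_, holds_nat.2 (by simp_all)⟩
    simp_all
    omega
  · have := Nat.size_le_size (Nat.sub_le a.1 a.2)
    simp
    omega

theorem PT.half_aux : PT A fun n : ℕ => n / 2 := by
  refine ⟨⟨.half 0 0, 1 + .X, fun a s hs => ?_⟩, .X, fun a => ?_⟩
  · rw [holds_nat] at hs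
    refine ⟨_, _, .half 0 0 s, ?_, holds_nat.2 (by simp_all)⟩
    simp_all
  · have := Nat.size_le_size (Nat.div_le_self a 2)
    simpa

theorem PT.query_aux : PT A fun n : ℕ => oracleAnswer A n := by
  refine ⟨⟨.query 0 0, 1 + .X, fun a s hs => ?_⟩, 1, fun a => ?_⟩
  · rw [holds_nat] at hs
    refine ⟨_, _, .query 0 0 s, ?_, holds_nat.2 (by simp_all)⟩
    simp_all
  · simp only [oracleAnswer]
    split_ifs <;> simp

@[fun_prop]
theorem PT.add {f g : α → ℕ} (hf : PT A f) (hg : PT A g) : PT A fun a => f a + g a :=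
  PT.add_aux.comp (hf.pair hg)

@[fun_prop]
theorem PT.sub {f g : α → ℕ} (hf : PT A f) (hg : PT A g) : PT A fun a => f a - g a :=
  PT.sub_aux.comp (hf.pair hg)

@[fun_prop]
theorem PT.half {f : α → ℕ} (hf : PT A f) : PT A fun a => f a / 2 :=
  PT.half_aux.comp hf

@[fun_prop]
theorem PT.query {f : α → ℕ} (hf : PT A f) : PT A fun a => oracleAnswer A (f a) :=
  PT.query_aux.comp hf

theorem PT.ite_aux {f g : α → β} (hf : PT A f) (hg : PT A g) :
    PT A fun p : ℕ × α => if p.1 = 0 then f p.2 else g p.2 := by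
  obtain ⟨⟨P, q, hP⟩, r, hr⟩ := hf.comp (PT.snd (A := A) (α := ℕ))
  obtain ⟨⟨P', q', hP'⟩, r', hr'⟩ := hg.comp (PT.snd (A := A) (α := ℕ))
  refine ⟨⟨.ite 0 P' P, 1 + .X + (q + q'), fun a s hs => ?_⟩, r + r', fun a => ?_⟩
  · have h0 := (holds_nat_prod.1 hs).1
    by_cases h : a.1 = 0
    · obtain ⟨c, s', e, hc, h'⟩ := hP a s hs
      refine ⟨_, _, .ite_false (by omega) e, ?_, ?_⟩
      · simp [h0] at hc ⊢
        omega
      · simpa only [if_pos h] using h'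
    · obtain ⟨c, s', e, hc, h'⟩ := hP' a s hs
      refine ⟨_, _, .ite_true (by omega) e, ?_, ?_⟩
      · simp [h0] at hc ⊢
        omega
      · simpa only [if_neg h] using h'
  · rw [Polynomial.eval_add]
    have := hr a
    have := hr' a
    simp only at *
    split_ifs <;> omega

@[fun_prop]
theorem PT.ite_eq {h k : α → ℕ} {f g : α → β} (hh : PT A h) (hk : PT A k) (hf : PT A f)
    (hg : PT A g) : PT A fun a => if h a = k a then f a else g a := by
  -- With truncated subtraction, both differences vanish exactly when the two values agree.
  convert (PT.ite_aux hf hg).comp (((hh.sub hk).add (hk.sub hh)).pair PT.id) using 2 with a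
  congr 1
  exact propext (by omega)

@[fun_prop]
theorem PT.ite_le {h k : α → ℕ} {f g : α → β} (hh : PT A h) (hk : PT A k) (hf : PT A f)
    (hg : PT A g) : PT A fun a => if h a ≤ k a then f a else g a := by
  convert (PT.ite_aux hf hg).comp ((hh.sub hk).pair PT.id) using 2 with a
  congr 1
  exact propext (by omega)

/-- The counter in register 0 is halved in every round, so there are exactly `N.size` rounds, each
on data of length at most `B`. -/
theorem Computes.loop {P : Prog} {q : Polynomial ℕ} {g : σ → σ}
    (hP : Computes A P q fun p : ℕ × σ => (p.1 / 2, g p.2)) {B : ℕ} (n : ℕ) :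
    ∀ (N : ℕ) (t : σ) (s : Regs), N.size = n → Holds s 0 (N, t) → n ≤ B →
      (∀ j ≤ n, mx (g^[j] t) ≤ B) →
      ∃ c s', Exec A (.loop 0 P) s c s' ∧ c ≤ (n + 1) * (1 + B + q.eval B) ∧
        Holds s' 0 ((0 : ℕ), g^[n] t) := by
  induction n with
  | zero =>
    intro N t s hN hs _ _
    rw [Nat.size_eq_zero] at hN
    subst hN
    have h0 := (holds_nat_prod.1 hs).1
    simp only at h0
    refine ⟨_, s, .loop_done h0, ?_, hs⟩
    simp [h0]
    omega
  | succ n ih =>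
    intro N t s hN hs hB ht
    have h0 := (holds_nat_prod.1 hs).1
    simp only at h0
    have hN0 : N ≠ 0 := by rintro rfl; simp at hN
    obtain ⟨c, s', e, hc, h⟩ := hP _ s hs
    obtain ⟨c', s'', e', hc', h'⟩ := ih (N / 2) (g t) s' (by rw [size_half]; omega) h (by omega)
      fun j hj => by
        rw [← Function.iterate_succ_apply]
        exact ht (j + 1) (by omega)
    refine ⟨_, s'', .loop_step (by omega) e e', ?_, h'⟩
    have : q.eval (mx (N, t)) ≤ q.eval B := eval_mono q (by
      have := ht 0 (by omega)
      simp only [mx_prod, mx_nat, Function.iterate_zero, id] at this ⊢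
      omega)
    rw [h0, hN]
    calc _ ≤ 1 + B + q.eval B + (n + 1) * (1 + B + q.eval B) := by gcongr; exact hc.trans this
      _ = _ := by ring

/-- Iterating a polynomial-time step can make numbers exponentially long (repeated squaring), hence
the hypothesis `hb` on all intermediate states. The parameter `a` is carried along with the state.
-/
theorem PT.iterate {fuel : α → ℕ} {init : α → σ} {step : α → σ → σ} (hfuel : PT A fuel)
    (hinit : PT A init) (hstep : PT A fun p : α × σ => step p.1 p.2) (b : Polynomial ℕ)
    (hb : ∀ a, ∀ j ≤ (fuel a).size, mx ((step a)^[j] (init a)) ≤ b.eval (mx a)) :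
    PT A fun a => (step a)^[(fuel a).size] (init a) := by
  have hbody : PT A fun p : ℕ × (α × σ) => (p.1 / 2, (p.2.1, step p.2.1 p.2.2)) :=
    (PT.half PT.fst).pair ((PT.fst.comp PT.snd).pair (hstep.comp PT.snd))
  obtain ⟨⟨P, q, hP⟩, -⟩ := hbody
  have hpre : PT A fun a => (fuel a, (a, init a)) := hfuel.pair (PT.id.pair hinit)
  obtain ⟨r, hr⟩ := hfuel.2
  have hit : ∀ a j x, (fun p : α × σ => (p.1, step p.1 p.2))^[j] (a, x) = (a, (step a)^[j] x) := by
    intro a j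
    induction j with
    | zero => intro x; rfl
    | succ j ih => intro x; exact ih _
  obtain ⟨⟨P₀, q₀, hP₀⟩, -⟩ := hpre
  obtain ⟨⟨P₁, q₁, hP₁⟩, -⟩ : PT A fun p : ℕ × (α × σ) => p.2.2 := PT.snd.comp PT.snd
  let B : Polynomial ℕ := b + r + .X
  refine ⟨⟨.seq P₀ (.seq (.loop 0 P) P₁), q₀ + ((r + 1) * (1 + B + q.comp B) + q₁.comp B),
    fun a s hs => ?_⟩, b, fun a => hb a _ le_rfl⟩
  obtain ⟨c₀, s₀, e₀, hc₀, h₀⟩ := hP₀ a s hs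
  have hr' : (fuel a).size ≤ r.eval (mx a) := by simpa using hr a
  have hB : B.eval (mx a) = b.eval (mx a) + r.eval (mx a) + mx a := by simp [B]
  have hj : ∀ j ≤ (fuel a).size, mx ((fun p : α × σ => (p.1, step p.1 p.2))^[j] (a, init a)) ≤
      B.eval (mx a) := by
    intro j hj
    have := hb a j hj
    rw [hit, mx_prod, hB]
    simp only
    omega
  obtain ⟨c, s', e, hc, h⟩ := hP.loop (B := B.eval (mx a)) _ _ _ s₀ rfl h₀ (by omega) hj
  rw [hit] at h
  obtain ⟨c₁, s₁, e₁, hc₁, h₁⟩ := hP₁ _ s' h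
  refine ⟨_, s₁, .seq e₀ (.seq e e₁), ?_, h₁⟩
  simp only [Polynomial.eval_add, Polynomial.eval_mul, Polynomial.eval_one, Polynomial.eval_comp]
    at hc ⊢
  refine add_le_add hc₀ (add_le_add (hc.trans ?_) (hc₁.trans (eval_mono q₁ ?_)))
  · gcongr
  · have := hj _ le_rfl
    rw [hit] at this
    simpa using this

/-- Iteration of a step that makes the data longer by a bounded amount. -/
theorem PT.iterate_of_growth {fuel : α → ℕ} {init : α → σ} {step : α → σ → σ} (hfuel : PT A fuel)
    (hinit : PT A init) (hstep : PT A fun p : α × σ => step p.1 p.2) (b : Polynomial ℕ)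
    (hb : ∀ a x, mx (step a x) ≤ mx x + b.eval (mx a)) :
    PT A fun a => (step a)^[(fuel a).size] (init a) := by
  obtain ⟨r, hr⟩ := hfuel.2
  obtain ⟨i, hi⟩ := hinit.2
  refine hfuel.iterate hinit hstep (i + r * b) fun a j hj => ?_
  have : mx ((step a)^[j] (init a)) ≤ mx (init a) + j * b.eval (mx a) := by
    clear hj
    induction j with
    | zero => simp
    | succ j ih =>
      rw [Function.iterate_succ_apply']
      have := hb a ((step a)^[j] (init a))
      rw [add_mul]
      omega
  have hr' : (fuel a).size ≤ r.eval (mx a) := by simpa using hr a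
  simp only [Polynomial.eval_add, Polynomial.eval_mul]
  exact this.trans (add_le_add (hi a) (Nat.mul_le_mul (hj.trans hr') le_rfl))

end

/-! ### Arithmetic in polynomial time -/

section

variable {α : Type} [RegEnc α] {A : Language Bool}

@[fun_prop]
theorem PT.mod_two {f : α → ℕ} (hf : PT A f) : PT A fun a => f a % 2 := by
  have h : PT A fun a => f a - (f a / 2 + f a / 2) := by fun_prop
  convert h using 2
  omega

/-- Shift and add: the state holds the rest of one factor, the doubled other factor and the
accumulated sum. -/
theorem PT.mul_aux : PT A fun p : ℕ × ℕ => p.1 * p.2 := by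
  let step : ℕ × ℕ × ℕ → ℕ × ℕ × ℕ := fun σ =>
    (σ.1 / 2, σ.2.1 + σ.2.1, if σ.1 % 2 = 0 then σ.2.2 else σ.2.2 + σ.2.1)
  have h : PT A fun p : ℕ × ℕ => step^[p.1.size] (p.1, p.2, 0) := by
    refine PT.iterate_of_growth (fuel := Prod.fst) (init := fun p => (p.1, p.2, 0))
      (step := fun _ => step) (by fun_prop) (by fun_prop) (by fun_prop) 1 fun a x => ?_
    have h₁ := Nat.size_le_size (Nat.div_le_self x.1 2)
    have h₂ := size_add_le x.2.1 x.2.1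
    have h₃ := size_add_le x.2.2 x.2.1
    simp only [step, mx_prod, mx_nat, Polynomial.eval_one]
    split_ifs <;> omega
  have hs : ∀ n a p c, a.size = n → (step^[n] (a, p, c)).2.2 = c + a * p := by
    intro n
    induction n with
    | zero => intro a p c ha; rw [Nat.size_eq_zero] at ha; simp [ha]
    | succ n ih =>
      intro a p c ha
      rw [Function.iterate_succ_apply, ih _ _ _ (by simp [size_half, ha])]
      have h := Nat.div_add_mod a 2
      simp only
      split_ifs with h0
      · rw [h0] at h
        nlinarith
      · rw [Nat.mod_two_ne_zero.1 h0] at h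
        nlinarith
  convert (PT.snd.comp PT.snd).comp h using 2 with p
  rw [hs _ _ _ _ rfl, zero_add]

@[fun_prop]
theorem PT.mul {f g : α → ℕ} (hf : PT A f) (hg : PT A g) : PT A fun a => f a * g a :=
  PT.mul_aux.comp (hf.pair hg)

/-- Here and below the exponent is a length, not a value: otherwise the result would be
exponentially long. -/
theorem PT.two_pow_size_aux : PT A fun n : ℕ => 2 ^ n.size := by
  have h : PT A fun n : ℕ => (fun x => x + x)^[n.size] 1 :=
    PT.iterate_of_growth (fuel := fun n => n) (init := fun _ => 1) (step := fun _ x => x + x)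
      (by fun_prop) (by fun_prop) (by fun_prop) 1 fun a x => by simpa using size_add_le x x
  convert h using 2 with n
  induction n.size with
  | zero => rfl
  | succ k ih => rw [Function.iterate_succ_apply', ← ih, pow_succ, mul_two]

theorem PT.pow_size_aux : PT A fun p : ℕ × ℕ => p.1 ^ p.2.size := by
  have h : PT A fun p : ℕ × ℕ => (fun x => x * p.1)^[p.2.size] 1 :=
    PT.iterate_of_growth (fuel := Prod.snd) (init := fun _ => 1) (step := fun p x => x * p.1)
      (by fun_prop) (by fun_prop) (by fun_prop) .X fun a x => by
        have := size_mul_le x a.1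
        simp
        omega
  convert h using 2 with p
  induction p.2.size with
  | zero => rfl
  | succ k ih => rw [Function.iterate_succ_apply', ← ih, pow_succ]

theorem size_factorial_le (n : ℕ) : (n.factorial).size ≤ n * n + 1 := by
  rw [Nat.size_le]
  calc n.factorial ≤ n ^ n := Nat.factorial_le_pow n
    _ ≤ (2 ^ n) ^ n := Nat.pow_le_pow_left Nat.lt_two_pow_self.le n
    _ = 2 ^ (n * n) := (pow_mul ..).symm
    _ < _ := Nat.pow_lt_pow_right (by norm_num) (Nat.lt_succ_self _)

theorem PT.factorial_size_aux : PT A fun n : ℕ => n.size.factorial := by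
  let step : ℕ × ℕ → ℕ × ℕ := fun σ => (σ.1 + 1, (σ.1 + 1) * σ.2)
  have hs : ∀ j, step^[j] (0, 1) = (j, j.factorial) := by
    intro j
    induction j with
    | zero => rfl
    | succ j ih => rw [Function.iterate_succ_apply', ih, Nat.factorial_succ]
  have h : PT A fun n : ℕ => step^[n.size] (0, 1) := by
    refine PT.iterate (fuel := fun n => n) (init := fun _ => (0, 1)) (step := fun _ => step)
      (by fun_prop) (by fun_prop) (by fun_prop) (.X + .X * .X + 1) fun a j hj => ?_
    have h₁ := size_self_le j
    have h₂ := size_factorial_le j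
    have := Nat.mul_le_mul hj hj
    rw [hs]
    simp
    constructor <;> nlinarith
  convert PT.snd.comp h using 2 with n
  rw [hs]

/-- The greatest `z < 2 ^ (U.size + 1)` with `c z ≠ 0`, found by binary search. -/
def bsearch (c : ℕ → ℕ) (U : ℕ) : ℕ :=
  ((fun σ : ℕ × ℕ => if c (σ.1 + σ.2) = 0 then (σ.1, σ.2 / 2) else (σ.1 + σ.2, σ.2 / 2))^[
    (2 ^ U.size).size] (0, 2 ^ U.size)).1

theorem bsearch_spec {c : ℕ → ℕ} {U : ℕ} (h0 : c 0 ≠ 0) (hU : ∀ z, c z ≠ 0 → z ≤ U)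
    (hc : ∀ y z, y ≤ z → c z ≠ 0 → c y ≠ 0) :
    c (bsearch c U) ≠ 0 ∧ ∀ z, c z ≠ 0 → z ≤ bsearch c U := by
  let step : ℕ × ℕ → ℕ × ℕ := fun σ =>
    if c (σ.1 + σ.2) = 0 then (σ.1, σ.2 / 2) else (σ.1 + σ.2, σ.2 / 2)
  -- Invariant of the search: the answer lies in the interval from `z` to `z + 2 ^ (i + 1)`, right
  -- end excluded, and each round halves it.
  have key : ∀ i z, c z ≠ 0 → c (z + 2 ^ (i + 1)) = 0 →
      c (step^[i + 1] (z, 2 ^ i)).1 ≠ 0 ∧ c ((step^[i + 1] (z, 2 ^ i)).1 + 1) = 0 := by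
    intro i
    induction i with
    | zero =>
      intro z hz hz'
      simp only [Function.iterate_one, step, zero_add, pow_zero]
      split_ifs with h
      · exact ⟨hz, h⟩
      · exact ⟨h, hz'⟩
    | succ i ih =>
      intro z hz hz'
      rw [Function.iterate_succ_apply]
      have h2 : 2 ^ (i + 1) / 2 = 2 ^ i := by rw [pow_succ]; simp
      by_cases h : c (z + 2 ^ (i + 1)) = 0
      · simp only [step, if_pos h, h2] at ih ⊢
        exact ih z hz h
      · simp only [step, if_neg h, h2] at ih ⊢
        refine ih _ h ?_
        rwa [add_assoc, ← two_mul, ← pow_succ']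
  have hpow : c (0 + 2 ^ (U.size + 1)) = 0 := by
    by_contra h
    have := hU _ h
    have := Nat.lt_size_self U
    rw [pow_succ] at *
    omega
  obtain ⟨h₁, h₂⟩ := key U.size 0 h0 hpow
  have hb : bsearch c U = (step^[U.size + 1] (0, 2 ^ U.size)).1 := by
    rw [bsearch, Nat.size_pow]
  rw [hb]
  refine ⟨h₁, fun z hz => ?_⟩
  by_contra! hlt
  exact hc _ _ hlt hz h₂

theorem PT.bsearch {c : α → ℕ → ℕ} {U : α → ℕ} (hc : PT A fun p : α × ℕ => c p.1 p.2)
    (hU : PT A U) : PT A fun a => bsearch (c a) (U a) := by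
  refine PT.fst.comp (PT.iterate_of_growth (fuel := fun a => 2 ^ (U a).size)
    (init := fun a => (0, 2 ^ (U a).size))
    (step := fun a σ => if c a (σ.1 + σ.2) = 0 then (σ.1, σ.2 / 2) else (σ.1 + σ.2, σ.2 / 2))
    (PT.two_pow_size_aux.comp hU) ((PT.const 0).pair (PT.two_pow_size_aux.comp hU)) ?_ 1
    fun a x => ?_)
  · have : PT A fun p : α × (ℕ × ℕ) => c p.1 (p.2.1 + p.2.2) :=
      hc.comp (f := fun p : α × (ℕ × ℕ) => (p.1, p.2.1 + p.2.2)) (by fun_prop)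
    fun_prop
  · have h₁ := Nat.size_le_size (Nat.div_le_self x.2 2)
    have h₂ := size_add_le x.1 x.2
    split_ifs <;> simp only [mx_prod, mx_nat, Polynomial.eval_one] <;> omega

theorem PT.div_aux : PT A fun p : ℕ × ℕ => p.1 / p.2 := by
  -- A zero divisor is treated apart, because then every `z` passes the test and the search has no
  -- bound.
  have h : PT A fun p : ℕ × ℕ => if p.2 = 0 then 0 else
      ConfOpt.bsearch (fun z => if z * p.2 ≤ p.1 then 1 else 0) p.1 := by
    have : PT A fun p : ℕ × ℕ =>
        ConfOpt.bsearch (fun z => if z * p.2 ≤ p.1 then 1 else 0) p.1 :=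
      PT.bsearch (by fun_prop) (by fun_prop)
    fun_prop
  convert h using 2 with p
  split_ifs with h0
  · rw [h0, Nat.div_zero]
  · have hp := Nat.pos_of_ne_zero h0
    obtain ⟨h₁, h₂⟩ := bsearch_spec (c := fun z => if z * p.2 ≤ p.1 then 1 else 0) (U := p.1)
      (by simp) (fun z hz => by
        by_contra! h
        simp only [ne_eq, ite_eq_right_iff, one_ne_zero, imp_false, not_not] at hz
        nlinarith) (fun y z hyz hz => by
        simp only [ne_eq, ite_eq_right_iff, one_ne_zero, imp_false, not_not] at hz ⊢
        exact (Nat.mul_le_mul_right _ hyz).trans hz)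
    simp only [ne_eq, ite_eq_right_iff, one_ne_zero, imp_false, not_not] at h₁ h₂
    exact le_antisymm (h₂ _ (Nat.div_mul_le_self _ _)) ((Nat.le_div_iff_mul_le hp).2 h₁)

@[fun_prop]
theorem PT.div {f g : α → ℕ} (hf : PT A f) (hg : PT A g) : PT A fun a => f a / g a :=
  PT.div_aux.comp (hf.pair hg)

@[fun_prop]
theorem PT.mod {f g : α → ℕ} (hf : PT A f) (hg : PT A g) : PT A fun a => f a % g a := by
  simp only [Nat.mod_eq_sub_mul_div]
  fun_prop

/-- In Euclid's algorithm with `b ≤ a` one has `2 * (a % b) ≤ a`, so each step at least halves the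
product of the pair, and the length of the product bounds the number of rounds. -/
theorem PT.gcd_aux : PT A fun p : ℕ × ℕ => p.1.gcd p.2 := by
  let step : ℕ × ℕ → ℕ × ℕ := fun σ => if σ.2 = 0 then σ else (σ.2, σ.1 % σ.2)
  have hs : ∀ n a b, b ≤ a → a * b < 2 ^ n → step^[n] (a, b) = (a.gcd b, 0) := by
    intro n
    induction n with
    | zero =>
      intro a b hab h
      have : b = 0 := by
        rw [pow_zero, Nat.lt_one_iff, mul_eq_zero] at h
        omega
      simp [this]
    | succ n ih =>
      intro a b hab h
      rw [Function.iterate_succ_apply]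
      by_cases hb : b = 0
      · subst hb
        simpa [step] using ih a 0 hab (by simp)
      · have h₁ := Nat.mod_lt a (Nat.pos_of_ne_zero hb)
        have h₂ := Nat.div_add_mod a b
        have h₃ : 1 ≤ a / b := Nat.div_pos hab (Nat.pos_of_ne_zero hb)
        have h₄ : 2 * (a % b) ≤ a := by nlinarith
        simp only [step, if_neg hb] at ih ⊢
        rw [ih _ _ h₁.le (by rw [pow_succ] at h; nlinarith), Nat.gcd_comm b, ← Nat.gcd_rec,
          Nat.gcd_comm]
  -- Starting from `p.1 + p.2` puts the pair in the right order without changing the gcd.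
  have h : PT A fun p : ℕ × ℕ => step^[((p.1 + p.2) * p.2).size] (p.1 + p.2, p.2) := by
    refine PT.iterate_of_growth (fuel := fun p : ℕ × ℕ => (p.1 + p.2) * p.2)
      (init := fun p : ℕ × ℕ => (p.1 + p.2, p.2)) (step := fun _ => step)
      (by fun_prop) (by fun_prop) (by fun_prop) 0 fun a x => ?_
    have := Nat.size_le_size (Nat.mod_le x.1 x.2)
    simp only [step]
    split_ifs <;> simp only [mx_prod, mx_nat, Polynomial.eval_zero] <;> omega
  convert PT.fst.comp h using 2 with p
  rw [hs _ _ _ (by omega) (Nat.lt_size_self _)]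
  simp

@[fun_prop]
theorem PT.gcd {f g : α → ℕ} (hf : PT A f) (hg : PT A g) : PT A fun a => (f a).gcd (g a) :=
  PT.gcd_aux.comp (hf.pair hg)

end

/-! ### Reading and writing numbers -/

theorem strCode_cons (b : Bool) (w : List Bool) : strCode (b :: w) = 2 * strCode w + b.toNat := by
  cases b <;> rfl

theorem encodeNat_zero : encodeNat 0 = [false] := by simp [encodeNat]

theorem encodeNat_of_ne_zero {k : ℕ} (hk : k ≠ 0) :
    encodeNat k = true :: decide (k % 2 = 1) :: encodeNat (k / 2) := by
  obtain ⟨b, m, rfl⟩ : ∃ b m, k = Nat.bit b m := ⟨k.bodd, k.div2, (Nat.bit_bodd_div2 k).symm⟩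
  rw [Nat.bit_div_two, encodeNat, Nat.bits_append_bit _ _ (by rintro rfl; cases b <;> simp_all)]
  cases b <;> simp [encodeNat, Nat.bit]

theorem strCode_encodeNat {k : ℕ} (hk : k ≠ 0) (w : List Bool) :
    strCode (encodeNat k ++ w) = 4 * strCode (encodeNat (k / 2) ++ w) + 2 * (k % 2) + 1 := by
  rw [encodeNat_of_ne_zero hk, List.cons_append, List.cons_append, strCode_cons, strCode_cons]
  rcases Nat.mod_two_eq_zero_or_one k with h | h <;> simp [h] <;> ring

theorem strCode_encodeNat_zero (w : List Bool) :
    strCode (encodeNat 0 ++ w) = 2 * strCode w := by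
  rw [encodeNat_zero, List.singleton_append, strCode_cons]
  rfl

/-- The step of the loop that writes a number. -/
def writeStep (σ : ℕ × ℕ × ℕ) : ℕ × ℕ × ℕ :=
  (σ.1 / 2, 4 * σ.2.1, σ.2.2 + σ.2.1 + 2 * (σ.1 % 2) * σ.2.1)

/-- The code of `encodeNat k ++ w`, from `k` and the code of `w`. -/
def writeNat (k w : ℕ) : ℕ :=
  let r := writeStep^[k.size] (k, 1, 0)
  r.2.2 + r.2.1 * (2 * w)

theorem writeNat_strCode (k : ℕ) (w : List Bool) :
    writeNat k (strCode w) = strCode (encodeNat k ++ w) := by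
  -- In a run, `c` is the part already written and `p` the power of 4 at which the rest begins.
  have key : ∀ n k p c, k.size = n → (writeStep^[n] (k, p, c)).2.2 +
      (writeStep^[n] (k, p, c)).2.1 * (2 * strCode w) =
        c + p * strCode (encodeNat k ++ w) := by
    intro n
    induction n with
    | zero =>
      intro k p c hk
      rw [Nat.size_eq_zero] at hk
      rw [hk, strCode_encodeNat_zero]
      rfl
    | succ n ih =>
      intro k p c hk
      have hk0 : k ≠ 0 := by rintro rfl; simp at hk
      rw [Function.iterate_succ_apply]
      refine (ih _ _ _ (by simp [size_half, hk])).trans ?_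
      rw [strCode_encodeNat hk0]
      ring
  simpa [writeNat] using key _ k 1 0 rfl

/-- The step of the loop that reads a number. -/
def readStep (σ : ℕ × ℕ × ℕ) : ℕ × ℕ × ℕ :=
  if σ.2.2 % 2 = 0 then σ else
    (if σ.2.2 / 2 % 2 = 0 then σ.1 else σ.1 + σ.2.1, σ.2.1 + σ.2.1, σ.2.2 / 2 / 2)

/-- The inverse of `writeNat`. -/
def readNat (z : ℕ) : ℕ × ℕ :=
  let r := readStep^[z.size] (0, 1, z)
  (r.1, r.2.2 / 2)

theorem size_le_strCode_encodeNat (k : ℕ) (w : List Bool) :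
    k.size ≤ (strCode (encodeNat k ++ w)).size := by
  refine Nat.size_le_size ?_
  induction k using Nat.strong_induction_on with
  | _ k ih =>
    by_cases hk : k = 0
    · simp [hk]
    · have := ih (k / 2) (by omega)
      rw [strCode_encodeNat hk]
      omega

/-- The terminating bit 0 stops the reading: it is a fixed point of `readStep`, so surplus rounds do
no harm. The last halving in `readNat` removes it. -/
theorem readNat_strCode (k : ℕ) (w : List Bool) :
    readNat (strCode (encodeNat k ++ w)) = (k, strCode w) := by
  have key : ∀ n k p c, k.size ≤ n →
      (readStep^[n] (c, p, strCode (encodeNat k ++ w))).1 = c + p * k ∧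
        (readStep^[n] (c, p, strCode (encodeNat k ++ w))).2.2 = 2 * strCode w := by
    intro n
    induction n with
    | zero =>
      intro k p c hk
      rw [Nat.le_zero, Nat.size_eq_zero] at hk
      rw [hk, strCode_encodeNat_zero]
      simp
    | succ n ih =>
      intro k p c hk
      rw [Function.iterate_succ_apply]
      by_cases hk0 : k = 0
      · subst hk0
        rw [strCode_encodeNat_zero]
        have := ih 0 p c (by simp)
        rw [strCode_encodeNat_zero] at this
        simpa [readStep] using this
      · obtain ⟨h₁, h₂⟩ := ih (k / 2) (p + p) (if k % 2 = 0 then c else c + p)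
          (by rw [size_half]; omega)
        have hs : readStep (c, p, strCode (encodeNat k ++ w)) =
            (if k % 2 = 0 then c else c + p, p + p, strCode (encodeNat (k / 2) ++ w)) := by
          rw [strCode_encodeNat hk0, readStep, if_neg (by simp only; omega)]
          simp only
          have e₁ : (4 * strCode (encodeNat (k / 2) ++ w) + 2 * (k % 2) + 1) / 2 % 2 = k % 2 := by
            omega
          have e₂ : (4 * strCode (encodeNat (k / 2) ++ w) + 2 * (k % 2) + 1) / 2 / 2 =
            strCode (encodeNat (k / 2) ++ w) := by omega
          rw [e₁, e₂]
        rw [hs, h₁, h₂]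
        refine ⟨?_, rfl⟩
        have h := Nat.div_add_mod k 2
        split_ifs with h0
        · rw [h0] at h
          nlinarith
        · rw [Nat.mod_two_ne_zero.1 h0] at h
          nlinarith
  obtain ⟨h₁, h₂⟩ := key _ k 1 0 (size_le_strCode_encodeNat k w)
  rw [readNat]
  simp [h₁, h₂]

section

variable {α : Type} [RegEnc α] {A : Language Bool}

theorem PT.writeNat_aux : PT A fun p : ℕ × ℕ => writeNat p.1 p.2 := by
  have h : PT A fun p : ℕ × ℕ => writeStep^[p.1.size] (p.1, 1, 0) := by
    refine PT.iterate_of_growth (fuel := Prod.fst) (init := fun p => (p.1, 1, 0))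
      (step := fun _ => writeStep) (by fun_prop) (by fun_prop) (by unfold writeStep; fun_prop) 4
      fun a x => ?_
    have h₁ := Nat.size_le_size (Nat.div_le_self x.1 2)
    have h₂ := size_mul_le 4 x.2.1
    have h₃ : x.2.2 + x.2.1 + 2 * (x.1 % 2) * x.2.1 ≤ x.2.2 + 4 * x.2.1 := by
      have := Nat.mod_lt x.1 (y := 2) (by norm_num)
      nlinarith
    have h₄ := (Nat.size_le_size h₃).trans (size_add_le _ _)
    have h₅ : Nat.size 4 = 3 := by decide
    simp only [writeStep, mx_prod, mx_nat]
    simp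
    omega
  unfold writeNat
  fun_prop

@[fun_prop]
theorem PT.writeNat {f g : α → ℕ} (hf : PT A f) (hg : PT A g) :
    PT A fun a => writeNat (f a) (g a) :=
  PT.writeNat_aux.comp (hf.pair hg)

theorem PT.readNat_aux : PT A readNat := by
  have h : PT A fun z : ℕ => readStep^[z.size] (0, 1, z) := by
    refine PT.iterate_of_growth (fuel := fun z => z) (init := fun z => (0, 1, z))
      (step := fun _ => readStep) (by fun_prop) (by fun_prop) (by unfold readStep; fun_prop) 1
      fun a x => ?_
    have h₀ := Nat.size_le_size (Nat.div_le_self x.2.2 2)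
    have h₁ := Nat.size_le_size (Nat.div_le_self (x.2.2 / 2) 2)
    have h₂ := size_add_le x.1 x.2.1
    have h₃ := size_add_le x.2.1 x.2.1
    simp only [readStep]
    split_ifs <;> simp only [mx_prod, mx_nat, Polynomial.eval_one] <;> omega
  unfold readNat
  fun_prop

@[fun_prop]
theorem PT.readNat {f : α → ℕ} (hf : PT A f) : PT A fun a => readNat (f a) :=
  PT.readNat_aux.comp hf

end

/-- This is needed for every `z`, even one that encodes nothing, since the growth bound for the
parser concerns arbitrary states. -/
theorem readNat_snd_le (z : ℕ) : (readNat z).2 ≤ z := by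
  have : ∀ n σ, (readStep^[n] σ).2.2 ≤ σ.2.2 := by
    intro n
    induction n with
    | zero => exact fun σ => le_rfl
    | succ n ih =>
      intro σ
      rw [Function.iterate_succ_apply]
      refine (ih _).trans ?_
      unfold readStep
      split_ifs <;> (try simp only) <;> omega
  exact (Nat.div_le_self _ _).trans (this _ _)

/-! ### Selecting disjuncts

A number `y` is read as a sequence of choices, one for each disjunction that is reached; this selects
a conjunction of leaves of the formula. The leaves are listed as pairs: `(1, 0)` is the constant 0,
`(2, i)` is the literal `¬ x_i` and `(3, i)` is the literal `x_i`. -/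

/-- The leaves that the choices `y` select, and the remaining choices. -/
def NNF.sel : NNF → ℕ → List (ℕ × ℕ) × ℕ
  | .const true, y => ([], y)
  | .const false, y => ([(1, 0)], y)
  | .lit p i, y => ([(2 + p.toNat, i)], y)
  | .and φ ψ, y => ((φ.sel y).1 ++ (ψ.sel (φ.sel y).2).1, (ψ.sel (φ.sel y).2).2)
  | .or φ ψ, y => if y % 2 = 0 then ψ.sel (y / 2) else φ.sel (y / 2)

/-- The number of nodes of a formula. -/
def NNF.tokens : NNF → ℕ
  | .const _ => 1
  | .lit _ _ => 1
  | .and φ ψ => 1 + φ.tokens + ψ.tokens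
  | .or φ ψ => 1 + φ.tokens + ψ.tokens

/-- Read one token. The state consists of the code of the rest of the formula, the remaining choices,
and a stack of bits that tell whether the pending subformulas are selected. The second component of
the result is the selected leaf, or `(0, _)` if there is none. -/
def parseStep (σ : ℕ × ℕ × ℕ) : (ℕ × ℕ × ℕ) × (ℕ × ℕ) :=
  -- The lowest bit of the stack is its top, and a leading 1 marks its bottom, so at most 1 means
  -- empty.
  if σ.2.2 ≤ 1 then (σ, (0, 0))
  else if σ.1 % 2 = 0 then
    if σ.1 / 2 % 2 = 0 then
      ((σ.1 / 2 / 2 / 2, σ.2.1, σ.2.2 / 2), (σ.2.2 % 2 * (1 - σ.1 / 2 / 2 % 2), 0))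
    else if σ.1 / 2 / 2 % 2 = 0 then
      ((σ.1 / 2 / 2 / 2, σ.2.1, 2 * (2 * (σ.2.2 / 2) + σ.2.2 % 2) + σ.2.2 % 2), (0, 0))
    else if σ.2.2 % 2 = 0 then
      ((σ.1 / 2 / 2 / 2, σ.2.1, 2 * (2 * (σ.2.2 / 2))), (0, 0))
    else
      -- Only a selected disjunction consumes a choice. The top bit is for the left disjunct, which
      -- is read next, the bit below for the right one.
      ((σ.1 / 2 / 2 / 2, σ.2.1 / 2,
        2 * (2 * (σ.2.2 / 2) + (1 - σ.2.1 % 2)) + σ.2.1 % 2), (0, 0))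
  else
    (((readNat (σ.1 / 2 / 2)).2, σ.2.1, σ.2.2 / 2),
      (σ.2.2 % 2 * (2 + σ.1 / 2 % 2), (readNat (σ.1 / 2 / 2)).1))

/-- Read one token and feed the selected leaf to `g`. -/
def runStep {β : Type} (g : ℕ × ℕ → β → β) (σ : (ℕ × ℕ × ℕ) × β) : (ℕ × ℕ × ℕ) × β :=
  ((parseStep σ.1).1, g (parseStep σ.1).2 σ.2)

section

variable {β : Type} {g : ℕ × ℕ → β → β}

/-- Throughout, `hg` says that a token without selected leaf leaves the accumulator alone. -/
theorem runStep_const (hg : ∀ i b, g (0, i) b = b) (c : Bool) (w : List Bool) (y S f : ℕ)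
    (hS : 0 < S) (hf : f < 2) (b : β) :
    runStep g ((strCode (encodeNNF (.const c) ++ w), y, 2 * S + f), b) =
      ((strCode w, y, S), if f = 0 ∨ c = true then b else g (1, 0) b) := by
  have h₁ : (2 * S + f) / 2 = S := by omega
  have h₂ : (2 * S + f) % 2 = f := by omega
  have h₃ : ¬2 * S + f ≤ 1 := by omega
  have h₄ : ∀ z, (2 * z + 1) / 2 = z := by omega
  simp only [encodeNNF, List.cons_append, List.nil_append, strCode_cons, runStep, parseStep, h₁, h₂,
    if_neg h₃]
  interval_cases f <;> cases c <;> simp [hg, h₄]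

theorem runStep_lit (hg : ∀ i b, g (0, i) b = b) (p : Bool) (i : ℕ) (w : List Bool) (y S f : ℕ)
    (hS : 0 < S) (hf : f < 2) (b : β) :
    runStep g ((strCode (encodeNNF (.lit p i) ++ w), y, 2 * S + f), b) =
      ((strCode w, y, S), if f = 0 then b else g (2 + p.toNat, i) b) := by
  have h₁ : (2 * S + f) / 2 = S := by omega
  have h₂ : (2 * S + f) % 2 = f := by omega
  have h₃ : ¬2 * S + f ≤ 1 := by omega
  have e₁ : ∀ z, (2 * z + 1) / 2 = z := by omega
  have e₂ : ∀ z, (2 * z + p.toNat) / 2 = z := by have := p.toNat_lt; omega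
  have e₃ : ∀ z, (2 * z + p.toNat) % 2 = p.toNat := by have := p.toNat_lt; omega
  have e₄ : ∀ z, (2 * z + 1) % 2 = 1 := by omega
  simp only [encodeNNF, List.cons_append, strCode_cons, runStep, parseStep, h₁, h₂,
    if_neg h₃, Bool.toNat_true, e₁, e₂, e₃, e₄, readNat_strCode]
  interval_cases f <;> simp [hg]

theorem runStep_and (hg : ∀ i b, g (0, i) b = b) (φ ψ : NNF) (w : List Bool) (y S f : ℕ)
    (hS : 0 < S) (hf : f < 2) (b : β) :
    runStep g ((strCode (encodeNNF (.and φ ψ) ++ w), y, 2 * S + f), b) =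
      ((strCode (encodeNNF φ ++ (encodeNNF ψ ++ w)), y, 2 * (2 * S + f) + f), b) := by
  have h₁ : (2 * S + f) / 2 = S := by omega
  have h₂ : (2 * S + f) % 2 = f := by omega
  have h₃ : ¬2 * S + f ≤ 1 := by omega
  have e₁ : ∀ z, (2 * z + 1) / 2 = z := by omega
  have e₄ : ∀ z, (2 * z + 1) % 2 = 1 := by omega
  simp [encodeNNF, strCode_cons, runStep, parseStep, h₁, h₂, if_neg h₃, e₁, e₄, hg]

theorem runStep_or_skip (hg : ∀ i b, g (0, i) b = b) (φ ψ : NNF) (w : List Bool) (y S : ℕ)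
    (hS : 0 < S) (b : β) :
    runStep g ((strCode (encodeNNF (.or φ ψ) ++ w), y, 2 * S), b) =
      ((strCode (encodeNNF φ ++ (encodeNNF ψ ++ w)), y, 2 * (2 * S)), b) := by
  have h₃ : ¬2 * S ≤ 1 := by omega
  have e₁ : ∀ z, (2 * z + 1) / 2 = z := by omega
  have e₄ : ∀ z, (2 * z + 1) % 2 = 1 := by omega
  simp [encodeNNF, strCode_cons, runStep, parseStep, if_neg h₃, e₁, e₄, hg]

theorem runStep_or (hg : ∀ i b, g (0, i) b = b) (φ ψ : NNF) (w : List Bool) (y S : ℕ)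
    (hS : 0 < S) (b : β) :
    runStep g ((strCode (encodeNNF (.or φ ψ) ++ w), y, 2 * S + 1), b) =
      ((strCode (encodeNNF φ ++ (encodeNNF ψ ++ w)), y / 2,
        2 * (2 * S + (1 - y % 2)) + y % 2), b) := by
  have h₁ : (2 * S + 1) / 2 = S := by omega
  have h₂ : (2 * S + 1) % 2 = 1 := by omega
  have h₃ : ¬2 * S + 1 ≤ 1 := by omega
  have e₁ : ∀ z, (2 * z + 1) / 2 = z := by omega
  have e₄ : ∀ z, (2 * z + 1) % 2 = 1 := by omega
  simp [encodeNNF, strCode_cons, runStep, parseStep, h₁, hS.ne', e₁, e₄, hg]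

/-- With flag 0 on top, all subformulas inherit the flag 0, so no choice is consumed; this matches
`NNF.sel`, which never visits the rejected disjunct. -/
theorem run_skip (hg : ∀ i b, g (0, i) b = b) (φ : NNF) (w : List Bool) (y S : ℕ) (hS : 0 < S)
    (b : β) :
    (runStep g)^[φ.tokens] ((strCode (encodeNNF φ ++ w), y, 2 * S), b) =
      ((strCode w, y, S), b) := by
  induction φ generalizing w S with
  | const c => simpa [NNF.tokens] using runStep_const hg c w y S 0 hS (by norm_num) b
  | lit p i => simpa [NNF.tokens] using runStep_lit hg p i w y S 0 hS (by norm_num) b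
  | and φ ψ ihφ ihψ =>
    have := runStep_and hg φ ψ w y S 0 hS (by norm_num) b
    rw [NNF.tokens, add_assoc, add_comm, Function.iterate_succ_apply, add_comm,
      Function.iterate_add_apply]
    simp only [add_zero] at this
    rw [this, ihφ _ _ (by omega), ihψ _ _ hS]
  | or φ ψ ihφ ihψ =>
    rw [NNF.tokens, add_assoc, add_comm, Function.iterate_succ_apply, add_comm,
      Function.iterate_add_apply, runStep_or_skip hg _ _ _ _ _ hS, ihφ _ _ (by omega), ihψ _ _ hS]

theorem run_sel (hg : ∀ i b, g (0, i) b = b) (φ : NNF) (w : List Bool) (y S : ℕ) (hS : 0 < S)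
    (b : β) :
    (runStep g)^[φ.tokens] ((strCode (encodeNNF φ ++ w), y, 2 * S + 1), b) =
      ((strCode w, (φ.sel y).2, S), (φ.sel y).1.foldl (fun b e => g e b) b) := by
  induction φ generalizing w y S b with
  | const c =>
    refine (runStep_const hg c w y S 1 hS (by norm_num) b).trans ?_
    cases c <;> simp [NNF.sel]
  | lit p i => simpa [NNF.tokens, NNF.sel] using runStep_lit hg p i w y S 1 hS (by norm_num) b
  | and φ ψ ihφ ihψ =>
    rw [NNF.tokens, add_assoc, add_comm, Function.iterate_succ_apply, add_comm,
      Function.iterate_add_apply, runStep_and hg _ _ _ _ _ _ hS (by norm_num),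
      ihφ _ _ _ (by omega), ihψ _ _ _ hS]
    simp [NNF.sel]
  | or φ ψ ihφ ihψ =>
    rw [NNF.tokens, add_assoc, add_comm, Function.iterate_succ_apply, add_comm,
      Function.iterate_add_apply, runStep_or hg _ _ _ _ _ hS, NNF.sel]
    rcases Nat.mod_two_eq_zero_or_one y with h | h
    · rw [h, if_pos rfl, add_zero, run_skip hg _ _ _ _ (by omega), ihψ _ _ _ hS]
    · rw [h, if_neg one_ne_zero, ihφ _ _ _ (by omega), Nat.sub_self, add_zero,
        run_skip hg _ _ _ _ hS]

end

theorem size_strCode (w : List Bool) : (strCode w).size = w.length + 1 := by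
  induction w with
  | nil => simp [strCode]
  | cons b w ih =>
    have : strCode w ≠ 0 := by intro h; simp [h] at ih
    rw [strCode, Nat.size_bit (by simp [Nat.bit_eq_zero_iff, this]), ih, List.length_cons]

theorem NNF.tokens_le (φ : NNF) : φ.tokens ≤ (encodeNNF φ).length := by
  induction φ with
  | const b => simp [tokens, encodeNNF]
  | lit p i => simp [tokens, encodeNNF]
  | and φ ψ ihφ ihψ => simp [tokens, encodeNNF]; omega
  | or φ ψ ihφ ihψ => simp [tokens, encodeNNF]; omega

/-- The initial stack 3 is the bottom mark and the flag 1 of the whole formula. Once the formula is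
read the stack is 1 and the state is fixed, so any number of rounds from `φ.tokens` on gives the
same result. -/
theorem run_formula {β : Type} {g : ℕ × ℕ → β → β} (hg : ∀ i b, g (0, i) b = b) (φ : NNF) (y : ℕ)
    (b : β) :
    ((runStep g)^[(strCode (encodeNNF φ)).size] ((strCode (encodeNNF φ), y, 3), b)).2 =
      (φ.sel y).1.foldl (fun b e => g e b) b := by
  have h := run_sel hg φ [] y 1 one_pos b
  rw [List.append_nil] at h
  obtain ⟨k, hk⟩ : ∃ k, (strCode (encodeNNF φ)).size = k + φ.tokens :=
    Nat.exists_eq_add_of_le' (by rw [size_strCode]; have := φ.tokens_le; omega)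
  rw [hk, Function.iterate_add_apply, h, Function.iterate_fixed]
  simp [runStep, parseStep, hg]

/-! ### The value of a selection -/

/-- The number of occurrences of a leaf. -/
def leafCount (x y k i : ℕ) : ℕ :=
  ((runStep fun e n => if e.1 = k then if e.2 = i then n + 1 else n else n)^[x.size]
    ((x, y, 3), 0)).2

theorem leafCount_formula (φ : NNF) (y i : ℕ) {k : ℕ} (hk : k ≠ 0) :
    leafCount (strCode (encodeNNF φ)) y k i = (φ.sel y).1.count (k, i) := by
  rw [leafCount, run_formula (by simp [hk.symm])]
  have : ∀ (l : List (ℕ × ℕ)) (n : ℕ), l.foldl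
      (fun n e => if e.1 = k then if e.2 = i then n + 1 else n else n) n =
        n + l.count (k, i) := by
    intro l
    induction l with
    | nil => intro n; rfl
    | cons e l ih =>
      intro n
      rw [List.foldl_cons, ih, List.count_cons]
      obtain ⟨e₁, e₂⟩ := e
      by_cases h₁ : e₁ = k <;> by_cases h₂ : e₂ = i <;> simp [h₁, h₂]; omega
  rw [this, zero_add]

theorem leafCount_le (x y k i : ℕ) : leafCount x y k i ≤ x.size := by
  have : ∀ n, ((runStep fun e n => if e.1 = k then if e.2 = i then n + 1 else n else n)^[n]
      ((x, y, 3), 0)).2 ≤ n := by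
    intro n
    induction n with
    | zero => exact le_rfl
    | succ n ih =>
      rw [Function.iterate_succ_apply', runStep]
      simp only
      split_ifs <;> omega
  exact this _

/-- Multiply numerator and denominator by those of the optimal value of a leaf. -/
def valueStep (c : ℕ → ℕ → ℕ) (e : ℕ × ℕ) (v : ℕ × ℕ) : ℕ × ℕ :=
  if e.1 = 0 then v else if e.1 = 1 then (0, v.2) else
    (v.1 * c e.1 e.2, v.2 * (c 2 e.2 + c 3 e.2))

/-- Numerator and denominator of the optimal value of a selection. -/
def selValue (x y : ℕ) : ℕ × ℕ :=
  -- Counts are recomputed at every leaf, which avoids a table of counts.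
  ((runStep (valueStep (leafCount x y)))^[x.size] ((x, y, 3), (1, 1))).2

/-- A common denominator of all values. -/
def commonDen (x : ℕ) : ℕ := x.size.factorial ^ x.size

/-- The verifier: is the value of the selection `y` at least the required one? -/
def verify (z y : ℕ) : ℕ :=
  if (readNat z).1 * (selValue (readNat z).2 y).2 ≤
    (selValue (readNat z).2 y).1 * commonDen (readNat z).2 then 1 else 0

/-! ### The verifier runs in polynomial time -/

section

variable {α : Type} [RegEnc α] {A : Language Bool}

@[fun_prop]
theorem PT.parseStep : PT A parseStep := by
  unfold ConfOpt.parseStep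
  fun_prop

theorem mx_parseStep_le (σ : ℕ × ℕ × ℕ) : mx (parseStep σ).1 ≤ mx σ + 3 := by
  obtain ⟨x, y, S⟩ := σ
  have hx : ∀ x' y' S', x' ≤ x → y' ≤ y → S' ≤ 4 * S → mx (x', y', S') ≤ mx (x, y, S) + 3 := by
    intro x' y' S' h₁ h₂ h₃
    have h₁ := Nat.size_le_size h₁
    have h₂ := Nat.size_le_size h₂
    have h₃ := (Nat.size_le_size h₃).trans (size_mul_le _ _)
    have h₄ : Nat.size 4 = 3 := by decide
    simp only [mx_prod, mx_nat]
    omega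
  have hr := readNat_snd_le (x / 2 / 2)
  simp only [parseStep]
  split_ifs <;> exact hx _ _ _ (by omega) (by omega) (by omega)

theorem PT.leafCount_aux : PT A fun a : ℕ × ℕ × ℕ × ℕ => leafCount a.1 a.2.1 a.2.2.1 a.2.2.2 := by
  refine PT.snd.comp (PT.iterate_of_growth (fuel := Prod.fst)
    (init := fun a : ℕ × ℕ × ℕ × ℕ => ((a.1, a.2.1, 3), 0))
    (step := fun a => runStep fun e n =>
      if e.1 = a.2.2.1 then if e.2 = a.2.2.2 then n + 1 else n else n)
    (by fun_prop) (by fun_prop) (by unfold runStep; fun_prop) 3 fun a x => ?_)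
  have h₁ := mx_parseStep_le x.1
  have h₂ := size_add_le x.2 1
  have h₃ : (x.2 + 1).size ≤ x.2.size + 1 := by
    rcases Nat.eq_zero_or_pos x.2 with hx | hx
    · simp [hx]
    · have := Nat.size_pos.2 hx
      simp at h₂ ⊢
      omega
  rw [runStep, mx_prod, mx_prod (p := x)]
  simp only [mx_nat]
  have : Polynomial.eval (mx a) (3 : Polynomial ℕ) = 3 := by simp
  split_ifs <;> omega

@[fun_prop]
theorem PT.leafCount {f₁ f₂ f₃ f₄ : α → ℕ} (h₁ : PT A f₁) (h₂ : PT A f₂) (h₃ : PT A f₃)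
    (h₄ : PT A f₄) : PT A fun a => leafCount (f₁ a) (f₂ a) (f₃ a) (f₄ a) :=
  PT.leafCount_aux.comp (h₁.pair (h₂.pair (h₃.pair h₄)))

theorem PT.selValue_aux : PT A fun a : ℕ × ℕ => selValue a.1 a.2 := by
  refine PT.snd.comp (PT.iterate_of_growth (fuel := Prod.fst)
    (init := fun a : ℕ × ℕ => ((a.1, a.2, 3), (1, 1)))
    (step := fun a => runStep (valueStep (ConfOpt.leafCount a.1 a.2)))
    (by fun_prop) (by fun_prop) (by unfold runStep valueStep; fun_prop) (.X + 3) fun a x => ?_)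
  have h₁ := mx_parseStep_le x.1
  -- Counts are at most the length of the input, so each factor adds at most linearly many digits.
  have hc : ∀ k i, (ConfOpt.leafCount a.1 a.2 k i).size ≤ a.1.size := fun k i =>
    (size_self_le _).trans (leafCount_le _ _ _ _)
  have h₂ := size_mul_le x.2.1
    (ConfOpt.leafCount a.1 a.2 (ConfOpt.parseStep x.1).2.1 (ConfOpt.parseStep x.1).2.2)
  have h₃ := size_mul_le x.2.2 (ConfOpt.leafCount a.1 a.2 2 (ConfOpt.parseStep x.1).2.2 +
    ConfOpt.leafCount a.1 a.2 3 (ConfOpt.parseStep x.1).2.2)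
  have h₄ := size_add_le (ConfOpt.leafCount a.1 a.2 2 (ConfOpt.parseStep x.1).2.2)
    (ConfOpt.leafCount a.1 a.2 3 (ConfOpt.parseStep x.1).2.2)
  have h₅ := hc (ConfOpt.parseStep x.1).2.1 (ConfOpt.parseStep x.1).2.2
  have h₆ := hc 2 (ConfOpt.parseStep x.1).2.2
  have h₇ := hc 3 (ConfOpt.parseStep x.1).2.2
  have h₈ : Polynomial.eval (mx a) (.X + 3 : Polynomial ℕ) = max a.1.size a.2.size + 3 := by simp
  rw [runStep, mx_prod, mx_prod (p := x), h₈, valueStep]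
  split_ifs <;> simp only [mx_prod (α := ℕ) (β := ℕ), mx_nat, Nat.size_zero] <;> omega

@[fun_prop]
theorem PT.selValue {f g : α → ℕ} (hf : PT A f) (hg : PT A g) :
    PT A fun a => selValue (f a) (g a) := by
  have h := PT.comp (A := A) (g := fun p : ℕ × ℕ => ConfOpt.selValue p.1 p.2)
    PT.selValue_aux (hf.pair hg)
  exact h

@[fun_prop]
theorem PT.commonDen {f : α → ℕ} (hf : PT A f) : PT A fun a => commonDen (f a) :=
  PT.pow_size_aux.comp ((PT.factorial_size_aux.comp hf).pair hf)

theorem PT.verify : PT A fun p : ℕ × ℕ => verify p.1 p.2 := by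
  unfold ConfOpt.verify
  fun_prop

end

/-! ### Confidence and selections -/

theorem Viterbi.val_nonneg (a : Viterbi) : 0 ≤ a.val := a.2.1

theorem Viterbi.val_le_one (a : Viterbi) : a.val ≤ 1 := a.2.2

theorem Viterbi.val_neg (a : Viterbi) : (Viterbi.neg a).val = 1 - a.val := rfl

theorem Viterbi.val_add (a b : Viterbi) : (a + b).val = max a.val b.val :=
  Monotone.map_max (f := (Subtype.val : unitInterval → ℝ)) fun _ _ h => h

theorem Viterbi.val_one : (1 : Viterbi).val = 1 := rfl

theorem Viterbi.val_zero : (0 : Viterbi).val = 0 := rfl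

/-- The value of a leaf if `x_i` has the value `p i`. -/
noncomputable def leafVal (p : ℕ → ℝ) (e : ℕ × ℕ) : ℝ :=
  if e.1 = 1 then 0 else if e.1 = 2 then 1 - p e.2 else p e.2

theorem leafVal_nonneg {p : ℕ → ℝ} (hp : ∀ i, 0 ≤ p i ∧ p i ≤ 1) (e : ℕ × ℕ) :
    0 ≤ leafVal p e := by
  have := hp e.2
  unfold leafVal
  split_ifs <;> linarith

/-- Every natural number `y` encodes some selection, so no condition on its length is needed here.
-/
theorem prod_sel_le_conf (π : ℕ → Viterbi) (φ : NNF) (y : ℕ) :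
    ((φ.sel y).1.map (leafVal fun i => (π i).val)).prod ≤ (Conf φ π).val := by
  induction φ generalizing y with
  | const b =>
    cases b
    · simp [NNF.sel, leafVal, Conf, Sem, Viterbi.val_zero]
    · simp [NNF.sel, Conf, Sem, Viterbi.val_one]
  | lit p i => cases p <;> simp [NNF.sel, leafVal, Conf, Sem, Viterbi.val_neg]
  | and φ ψ ihφ ihψ =>
    simp only [NNF.sel, List.map_append, List.prod_append]
    refine (mul_le_mul (ihφ _) (ihψ _) ?_ (Viterbi.val_nonneg _)).trans_eq rfl
    refine List.prod_nonneg fun a ha => ?_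
    obtain ⟨e, -, rfl⟩ := List.mem_map.1 ha
    exact leafVal_nonneg (fun i => ⟨Viterbi.val_nonneg _, Viterbi.val_le_one _⟩) e
  | or φ ψ ihφ ihψ =>
    have : (Conf (.or φ ψ) π).val = max (Conf φ π).val (Conf ψ π).val := Viterbi.val_add _ _
    rw [this, NNF.sel]
    split_ifs
    · exact (ihψ _).trans (le_max_right _ _)
    · exact (ihφ _).trans (le_max_left _ _)

/-- At each disjunction reached, take the disjunct of larger confidence. The arbitrary remainder `y`
lets the choices for the two parts of a conjunction be concatenated. -/
theorem exists_sel_eq_conf (π : ℕ → Viterbi) (φ : NNF) :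
    ∃ u : List Bool, u.length ≤ φ.tokens ∧ ∀ y, (φ.sel (u.foldr Nat.bit y)).2 = y ∧
      ((φ.sel (u.foldr Nat.bit y)).1.map (leafVal fun i => (π i).val)).prod = (Conf φ π).val := by
  induction φ with
  | const b =>
    refine ⟨[], by simp, fun y => ?_⟩
    cases b
    · simp [NNF.sel, leafVal, Conf, Sem, Viterbi.val_zero]
    · simp [NNF.sel, Conf, Sem, Viterbi.val_one]
  | lit p i =>
    refine ⟨[], by simp, fun y => ?_⟩
    cases p <;> simp [NNF.sel, leafVal, Conf, Sem, Viterbi.val_neg]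
  | and φ ψ ihφ ihψ =>
    obtain ⟨u, hu, h⟩ := ihφ
    obtain ⟨v, hv, h'⟩ := ihψ
    refine ⟨u ++ v, by simp [NNF.tokens]; omega, fun y => ?_⟩
    obtain ⟨h₁, h₂⟩ := h (v.foldr Nat.bit y)
    obtain ⟨h₃, h₄⟩ := h' y
    rw [List.foldr_append]
    simp only [NNF.sel, List.map_append, List.prod_append, h₁, h₂, h₃, h₄]
    exact ⟨trivial, rfl⟩
  | or φ ψ ihφ ihψ =>
    obtain ⟨u, hu, h⟩ := ihφ
    obtain ⟨v, hv, h'⟩ := ihψ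
    have hc : (Conf (.or φ ψ) π).val = max (Conf φ π).val (Conf ψ π).val := Viterbi.val_add _ _
    rcases le_total (Conf φ π).val (Conf ψ π).val with hle | hle
    · refine ⟨false :: v, by simp [NNF.tokens]; omega, fun y => ?_⟩
      rw [hc, max_eq_right hle, List.foldr_cons, NNF.sel, Nat.bit_mod_two, Nat.bit_div_two]
      exact h' y
    · refine ⟨true :: u, by simp [NNF.tokens]; omega, fun y => ?_⟩
      rw [hc, max_eq_left hle, List.foldr_cons, NNF.sel, Nat.bit_mod_two, Nat.bit_div_two]
      exact h y

theorem foldr_bit_one (u : List Bool) : u.foldr Nat.bit 1 = strCode u := by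
  induction u with
  | nil => rfl
  | cons b u ih => rw [List.foldr_cons, ih]; rfl

/-! ### The optimal value of a selection -/

/-- The numerator of the optimal value of a leaf. -/
def leafNum (E : List (ℕ × ℕ)) (e : ℕ × ℕ) : ℕ := if e.1 = 1 then 0 else E.count e

/-- The denominator of the optimal value of a leaf. -/
def leafDen (E : List (ℕ × ℕ)) (e : ℕ × ℕ) : ℕ :=
  -- The constant 0 gets the value 0/1, which keeps denominators positive.
  if e.1 = 1 then 1 else E.count (2, e.2) + E.count (3, e.2)

/-- All leaves are constants 0 or literals. -/
def IsLeafList (E : List (ℕ × ℕ)) : Prop := ∀ e ∈ E, e.1 = 1 ∨ e.1 = 2 ∨ e.1 = 3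

theorem isLeafList_sel (φ : NNF) (y : ℕ) : IsLeafList (φ.sel y).1 := by
  induction φ generalizing y with
  | const b => cases b <;> simp [NNF.sel, IsLeafList]
  | lit p i => cases p <;> simp [NNF.sel, IsLeafList]
  | and φ ψ ihφ ihψ =>
    intro e he
    rcases List.mem_append.1 he with he | he
    exacts [ihφ _ e he, ihψ _ e he]
  | or φ ψ ihφ ihψ =>
    rw [NNF.sel]
    split_ifs
    exacts [ihψ _, ihφ _]

theorem selValue_formula (φ : NNF) (y : ℕ) :
    selValue (strCode (encodeNNF φ)) y =
      (((φ.sel y).1.map (leafNum (φ.sel y).1)).prod,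
        ((φ.sel y).1.map (leafDen (φ.sel y).1)).prod) := by
  rw [selValue, run_formula (by simp [valueStep])]
  have : ∀ (l : List (ℕ × ℕ)) (v : ℕ × ℕ), IsLeafList l →
      l.foldl (fun v e => valueStep (leafCount (strCode (encodeNNF φ)) y) e v) v =
        (v.1 * (l.map (leafNum (φ.sel y).1)).prod, v.2 * (l.map (leafDen (φ.sel y).1)).prod) := by
    intro l
    induction l with
    | nil => intro v _; simp
    | cons e l ih =>
      intro v hl
      have he : e.1 ≠ 0 := by have := hl e (by simp); omega
      rw [List.foldl_cons, ih _ fun e he => hl e (by simp [he]), valueStep, if_neg he,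
        leafCount_formula _ _ _ he, leafCount_formula _ _ _ (by norm_num),
        leafCount_formula _ _ _ (by norm_num), List.map_cons, List.map_cons, List.prod_cons,
        List.prod_cons, ← mul_assoc, ← mul_assoc, leafNum, leafDen]
      split_ifs <;> simp
  rw [this _ _ (isLeafList_sel φ y), one_mul, one_mul]

theorem count_le_leafDen {E : List (ℕ × ℕ)} {e : ℕ × ℕ} (h : e.1 = 2 ∨ e.1 = 3) :
    E.count e ≤ leafDen E e := by
  obtain ⟨k, i⟩ := e
  rcases h with rfl | rfl <;> simp [leafDen]

theorem leafDen_pos {E : List (ℕ × ℕ)} (hE : IsLeafList E) {e : ℕ × ℕ} (he : e ∈ E) :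
    0 < leafDen E e := by
  rcases hE e he with h | h
  · simp [leafDen, h]
  · exact (List.count_pos_iff.2 he).trans_le (count_le_leafDen h)

/-- The interpretation that is optimal for a selection. -/
noncomputable def optInterp (E : List (ℕ × ℕ)) (i : ℕ) : ℝ :=
  (E.count (3, i) : ℝ) / (E.count (2, i) + E.count (3, i))

/-- A variable absent from `E` gets 0 / 0 = 0, which is also admissible. -/
theorem optInterp_mem (E : List (ℕ × ℕ)) (i : ℕ) : 0 ≤ optInterp E i ∧ optInterp E i ≤ 1 := by
  refine ⟨by unfold optInterp; positivity, div_le_one_of_le₀ ?_ (by positivity)⟩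
  exact le_add_of_nonneg_left (Nat.cast_nonneg _)

/-- The products run over occurrences, so a literal that occurs `b` times contributes its count `b`
times: this is how b^b and (a+b)^(a+b) arise. -/
theorem prod_optInterp {E : List (ℕ × ℕ)} (hE : IsLeafList E) :
    (E.map (leafVal (optInterp E))).prod * ((E.map (leafDen E)).prod : ℕ) =
      ((E.map (leafNum E)).prod : ℕ) := by
  rw [Nat.cast_list_prod, Nat.cast_list_prod, List.map_map, List.map_map, ← List.prod_map_mul]
  congr 1
  refine List.map_congr_left fun e he => ?_
  have hpos := leafDen_pos hE he
  obtain ⟨k, i⟩ := e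
  rcases hE _ he with h | h | h <;> simp only at h <;> subst h
  · simp [leafVal, leafNum]
  all_goals
    have h0 : ((E.count (2, i) : ℝ) + E.count (3, i)) ≠ 0 := by
      have : E.count (2, i) + E.count (3, i) ≠ 0 := by simpa [leafDen] using hpos.ne'
      exact_mod_cast this
    simp [leafVal, leafNum, leafDen, optInterp]
    field_simp
    try ring

/-- The equal terms of a repeated literal cancel the division by its count. A variable with both
signs then contributes ((1-p) + p)(a+b) = a+b, the number of its occurrences; if one sign is
missing, a nonnegative term is lost, whence only an inequality. -/
theorem sum_ratio_le {E : List (ℕ × ℕ)} (hE : ∀ e ∈ E, e.1 = 2 ∨ e.1 = 3) {p : ℕ → ℝ}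
    (hp : ∀ i, 0 ≤ p i ∧ p i ≤ 1) :
    (E.map fun e => leafVal p e * leafDen E e / E.count e).sum ≤ E.length := by
  let I : Finset ℕ := (E.map Prod.snd).toFinset
  have hsub : E.toFinset ⊆ ({2, 3} : Finset ℕ) ×ˢ I := by
    intro e he
    rw [List.mem_toFinset] at he
    simp only [Finset.mem_product, Finset.mem_insert, Finset.mem_singleton, I, List.mem_toFinset]
    exact ⟨hE e he, List.mem_map_of_mem he⟩
  -- Two instances of the equality test on pairs have to be identified.
  have hc : ∀ e, @List.count _ instBEqOfDecidableEq e E = E.count e := fun e => by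
    rw [lawful_beq_subsingleton instBEqOfDecidableEq instBEqProd]
  have hlen : (E.length : ℝ) = ∑ e ∈ ({2, 3} : Finset ℕ) ×ˢ I, (E.count e : ℝ) := by
    rw [← Finset.sum_subset hsub, ← List.sum_toFinset_count_eq_length, Nat.cast_sum]
    · simp only [hc]
    intro e _ he
    rw [List.mem_toFinset] at he
    simp [List.count_eq_zero_of_not_mem he]
  rw [Finset.sum_list_map_count, hlen]
  simp only [hc]
  calc _ = ∑ e ∈ E.toFinset, leafVal p e * leafDen E e := by
        refine Finset.sum_congr rfl fun e he => ?_
        have : (E.count e : ℝ) ≠ 0 := by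
          rw [List.mem_toFinset, ← List.count_pos_iff] at he
          exact_mod_cast he.ne'
        rw [nsmul_eq_mul]
        field_simp
    _ ≤ ∑ e ∈ ({2, 3} : Finset ℕ) ×ˢ I, leafVal p e * leafDen E e :=
        Finset.sum_le_sum_of_subset_of_nonneg hsub fun e _ _ =>
          mul_nonneg (leafVal_nonneg hp e) (Nat.cast_nonneg _)
    _ = _ := by
        rw [Finset.sum_product_right, Finset.sum_product_right]
        refine Finset.sum_congr rfl fun i _ => ?_
        rw [Finset.sum_pair (by norm_num), Finset.sum_pair (by norm_num)]
        simp [leafVal, leafDen]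
        ring

/-- This plays the role of the inequality of arithmetic and geometric means: x ≤ exp(x-1) is applied
to each factor. -/
theorem prod_le_exp_sum (l : List ℝ) (hl : ∀ x ∈ l, 0 ≤ x) :
    l.prod ≤ Real.exp (l.sum - l.length) := by
  induction l with
  | nil => simp
  | cons x l ih =>
    have h : x ≤ Real.exp (x - 1) := by linarith [Real.add_one_le_exp (x - 1)]
    have := ih fun x hx => hl x (by simp [hx])
    rw [List.prod_cons]
    calc x * l.prod ≤ Real.exp (x - 1) * Real.exp (l.sum - l.length) :=
          mul_le_mul h this (List.prod_nonneg fun x hx => hl x (by simp [hx])) (Real.exp_pos _).le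
      _ = _ := by
          rw [← Real.exp_add]
          congr 1
          simp
          ring

theorem prod_leafVal_le {E : List (ℕ × ℕ)} (hE : IsLeafList E) {p : ℕ → ℝ}
    (hp : ∀ i, 0 ≤ p i ∧ p i ≤ 1) :
    (E.map (leafVal p)).prod * ((E.map (leafDen E)).prod : ℕ) ≤ ((E.map (leafNum E)).prod : ℕ) := by
  by_cases h1 : ∃ e ∈ E, e.1 = 1
  · obtain ⟨e, he, h⟩ := h1
    have : (E.map (leafVal p)).prod = 0 :=
      List.prod_eq_zero (List.mem_map.2 ⟨e, he, by simp [leafVal, h]⟩)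
    rw [this, zero_mul]
    exact Nat.cast_nonneg _
  · push Not at h1
    have hE' : ∀ e ∈ E, e.1 = 2 ∨ e.1 = 3 := fun e he => (hE e he).resolve_left (h1 e he)
    -- The ratios of the factors to their optimal values have sum at most their number, so their
    -- product is at most exp(0) = 1.
    have hprod : (E.map fun e => leafVal p e * leafDen E e / E.count e).prod ≤ 1 := by
      refine (prod_le_exp_sum _ fun x hx => ?_).trans (Real.exp_le_one_iff.2 ?_)
      · obtain ⟨e, -, rfl⟩ := List.mem_map.1 hx
        have := leafVal_nonneg hp e
        positivity
      · rw [List.length_map]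
        linarith [sum_ratio_le hE' hp]
    rw [Nat.cast_list_prod, Nat.cast_list_prod, List.map_map, List.map_map, ← List.prod_map_mul]
    calc _ = (E.map fun e => leafVal p e * leafDen E e / E.count e *
            ((Nat.cast ∘ leafNum E) e : ℝ)).prod := by
          congr 1
          refine List.map_congr_left fun e he => ?_
          have h0 : (E.count e : ℝ) ≠ 0 := by
            exact_mod_cast (List.count_pos_iff.2 he).ne'
          simp only [Function.comp, leafNum, if_neg (h1 e he)]
          field_simp
      _ ≤ _ := by
          rw [List.prod_map_mul]
          refine mul_le_of_le_one_left (List.prod_nonneg fun x hx => ?_) hprod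
          obtain ⟨e, -, rfl⟩ := List.mem_map.1 hx
          exact Nat.cast_nonneg _

/-! ### Bounds on the denominators -/

/-- The number of literals in a selection. -/
def litCount (E : List (ℕ × ℕ)) : ℕ := E.countP fun e => e.1 ≠ 1

theorem count_add_count_le (E : List (ℕ × ℕ)) (i : ℕ) :
    E.count (2, i) + E.count (3, i) ≤ litCount E := by
  induction E with
  | nil => simp
  | cons e E ih =>
    obtain ⟨k, j⟩ := e
    simp only [litCount, List.count_cons, List.countP_cons] at *
    by_cases h₂ : k = 2 <;> by_cases h₃ : k = 3 <;> by_cases h₁ : k = 1 <;>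
      simp_all <;> (try split_ifs) <;> omega

theorem prod_leafDen_le (E : List (ℕ × ℕ)) :
    (E.map (leafDen E)).prod ≤ litCount E ^ litCount E := by
  have : ∀ l : List (ℕ × ℕ), (l.map (leafDen E)).prod ≤ litCount E ^ litCount l := by
    intro l
    induction l with
    | nil => simp [litCount]
    | cons e l ih =>
      rw [List.map_cons, List.prod_cons, leafDen]
      by_cases h : e.1 = 1
      · simpa [h, litCount] using ih
      · have hl : litCount (e :: l) = litCount l + 1 := by simp [litCount, h]
        rw [if_neg h, hl, pow_succ']
        exact Nat.mul_le_mul (count_add_count_le E _) ih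
  exact this E

/-- Each factor is positive and at most `M`, hence divides M!, and there are at most `M` factors.
The multiple depends only on the length bound, so it serves all selections at once. -/
theorem prod_leafDen_dvd {E : List (ℕ × ℕ)} (hE : IsLeafList E) {M : ℕ} (hM : E.length ≤ M) :
    (E.map (leafDen E)).prod ∣ M.factorial ^ M := by
  have : ∀ l : List (ℕ × ℕ), (∀ e ∈ l, e ∈ E) →
      (l.map (leafDen E)).prod ∣ M.factorial ^ l.length := by
    intro l
    induction l with
    | nil => simp
    | cons e l ih =>
      intro hl
      rw [List.map_cons, List.prod_cons, List.length_cons, pow_succ']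
      refine mul_dvd_mul ?_ (ih fun e he => hl e (by simp [he]))
      have he := hl e (by simp)
      refine Nat.dvd_factorial (leafDen_pos hE he) ?_
      have h₁ : litCount E ≤ E.length := List.countP_le_length
      have h₂ : 0 < E.length := List.length_pos_of_mem he
      have h₃ := count_add_count_le E e.2
      unfold leafDen
      split_ifs <;> omega
  exact (this E fun _ h => h).trans (pow_dvd_pow _ hM)

theorem length_sel_le (φ : NNF) (y : ℕ) : (φ.sel y).1.length ≤ φ.tokens := by
  induction φ generalizing y with
  | const b => cases b <;> simp [NNF.sel, NNF.tokens]
  | lit p i => simp [NNF.sel, NNF.tokens]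
  | and φ ψ ihφ ihψ =>
    have := ihφ y
    have := ihψ (φ.sel y).2
    simp [NNF.sel, NNF.tokens]
    omega
  | or φ ψ ihφ ihψ =>
    have := ihφ (y / 2)
    have := ihψ (y / 2)
    rw [NNF.sel, NNF.tokens]
    split_ifs <;> omega

theorem litCount_sel_le (φ : NNF) (y : ℕ) : litCount (φ.sel y).1 ≤ φ.size := by
  induction φ generalizing y with
  | const b => cases b <;> simp [NNF.sel, litCount]
  | lit p i => cases p <;> simp [NNF.sel, NNF.size, litCount]
  | and φ ψ ihφ ihψ =>
    have := ihφ y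
    have := ihψ (φ.sel y).2
    simp only [NNF.sel, NNF.size, litCount, List.countP_append] at *
    omega
  | or φ ψ ihφ ihψ =>
    have := ihφ (y / 2)
    have := ihψ (y / 2)
    rw [NNF.sel, NNF.size]
    split_ifs <;> omega

theorem NNF.vars_nonempty {φ : NNF} (h : φ.size ≠ 0) : φ.vars.Nonempty := by
  induction φ with
  | const b => simp [size] at h
  | lit p i => simp [vars]
  | and φ ψ ihφ ihψ | or φ ψ ihφ ihψ =>
    rw [vars, Finset.union_nonempty]
    by_cases h' : φ.size = 0
    · exact Or.inr (ihψ (by simpa [size, h'] using h))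
    · exact Or.inl (ihφ h')

theorem selValue_den_pos (φ : NNF) (y : ℕ) : 0 < (selValue (strCode (encodeNNF φ)) y).2 := by
  rw [selValue_formula]
  refine List.prod_pos fun a ha => ?_
  obtain ⟨e, he, rfl⟩ := List.mem_map.1 ha
  exact leafDen_pos (isLeafList_sel φ y) he

theorem selValue_den_dvd (φ : NNF) (y : ℕ) :
    (selValue (strCode (encodeNNF φ)) y).2 ∣ commonDen (strCode (encodeNNF φ)) := by
  rw [selValue_formula, commonDen, size_strCode]
  exact prod_leafDen_dvd (isLeafList_sel φ y)
    ((length_sel_le φ y).trans (φ.tokens_le.trans (Nat.le_succ _)))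

/-- The bound m^m is what the selection gives; it is weakened using n ≥ 1, valid when m > 0. For m =
0 both powers are 0^0 = 1. -/
theorem selValue_den_le (φ : NNF) (y : ℕ) :
    (selValue (strCode (encodeNNF φ)) y).2 ≤ φ.size ^ (φ.vars.card * φ.size) := by
  rw [selValue_formula]
  refine (prod_leafDen_le _).trans ?_
  have h := litCount_sel_le φ y
  by_cases h0 : φ.size = 0
  · rw [h0, Nat.le_zero] at h
    simp [h, h0]
  · have hc := Finset.card_pos.2 (NNF.vars_nonempty h0)
    exact (Nat.pow_le_pow_left h _).trans
      (Nat.pow_le_pow_right (by omega) (h.trans (Nat.le_mul_of_pos_left _ hc)))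

/-- With `exists_choices_ge` this shows that interpretations and selections have the same maximal
value; cross-multiplication avoids fractions. -/
theorem exists_conf_ge (φ : NNF) (y : ℕ) : ∃ π, ((selValue (strCode (encodeNNF φ)) y).1 : ℝ) ≤
    (Conf φ π).val * (selValue (strCode (encodeNNF φ)) y).2 := by
  let π : ℕ → Viterbi := fun i => ⟨optInterp (φ.sel y).1 i, optInterp_mem _ i⟩
  refine ⟨π, ?_⟩
  rw [selValue_formula, ← prod_optInterp (isLeafList_sel φ y)]
  exact mul_le_mul_of_nonneg_right (prod_sel_le_conf π φ y) (Nat.cast_nonneg _)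

theorem exists_choices_ge (φ : NNF) (π : ℕ → Viterbi) :
    ∃ u : List Bool, u.length ≤ (encodeNNF φ).length ∧
      (Conf φ π).val * (selValue (strCode (encodeNNF φ)) (strCode u)).2 ≤
        (selValue (strCode (encodeNNF φ)) (strCode u)).1 := by
  obtain ⟨u, hu, h⟩ := exists_sel_eq_conf π φ
  refine ⟨u, hu.trans φ.tokens_le, ?_⟩
  rw [← (h 1).2, foldr_bit_one, selValue_formula]
  exact prod_leafVal_le (isLeafList_sel φ _) fun i => ⟨Viterbi.val_nonneg _, Viterbi.val_le_one _⟩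

/-! ### The oracle and the algorithm -/

theorem strCode_injective : Function.Injective strCode := by
  intro v w h
  induction v generalizing w with
  | nil =>
    cases w with
    | nil => rfl
    | cons c w =>
      have := congrArg Nat.size h
      simp [size_strCode] at this
  | cons b v ih =>
    cases w with
    | nil =>
      have := congrArg Nat.size h
      simp [size_strCode] at this
    | cons c w =>
      rw [strCode_cons, strCode_cons] at h
      have hvw : strCode v = strCode w := by
        have := b.toNat_lt
        have := c.toNat_lt
        omega
      have hbc : b = c := by cases b <;> cases c <;> simp_all
      rw [hbc, ih hvw]

/-- The oracle: a number `z` followed by a formula is accepted if some selection has at least the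
value `z`, in units of the common denominator. -/
def valueOracle : Language Bool :=
  {w | ∃ y : List Bool, y.length ≤ w.length ∧ verify (strCode w) (strCode y) = 1}

/-- Functions computable in polynomial time have programs whose cost is polynomially bounded in the
length of the input strings. -/
theorem exists_prog_of_pt {A : Language Bool} {f : ℕ × ℕ → ℕ} (hf : PT A f) :
    ∃ (P : Prog) (q : Polynomial ℕ), ∀ x y, ∃ c s, Exec A P (initRegs x y) c s ∧
      c ≤ q.eval (max x.size y.size) ∧ s 0 = f (x, y) := by
  obtain ⟨⟨P, q, hP⟩, -⟩ := hf
  refine ⟨P, q, fun x y => ?_⟩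
  obtain ⟨c, s, e, hc, h⟩ := hP (x, y) (initRegs x y)
    (holds_nat_prod.2 ⟨rfl, holds_nat.2 rfl⟩)
  exact ⟨c, s, e, by simpa using hc, holds_nat.1 h⟩

theorem inNP_valueOracle : InNP valueOracle := by
  obtain ⟨V, q, hV⟩ := exists_prog_of_pt (A := 0) PT.verify
  refine ⟨.X, q.comp (.X + 1), V, fun x y => ?_, fun x => ?_⟩
  · obtain ⟨c, s, e, hc, -⟩ := hV (strCode x) (strCode y)
    refine ⟨c, s, e, hc.trans ?_⟩
    rw [Polynomial.eval_comp]
    refine eval_mono q ?_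
    simp [size_strCode]
  · change (∃ y : List Bool, _ ∧ _) ↔ _
    simp only [Polynomial.eval_X]
    refine exists_congr fun y => and_congr_right fun _ => ?_
    obtain ⟨c, s, e, -, h⟩ := hV (strCode x) (strCode y)
    constructor
    · exact fun hv => ⟨c, s, e, h.trans hv⟩
    · rintro ⟨c', s', e', h'⟩
      rw [← h', e'.det e, h]

/-- The optimal value of the formula with code `x`, in units of the common denominator. -/
noncomputable def optUnits (x : ℕ) : ℕ :=
  bsearch (fun z => oracleAnswer valueOracle (writeNat z x)) (commonDen x)

/-- The output of the algorithm. -/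
noncomputable def optConfString (w : List Bool) : List Bool :=
  encodeNat (optUnits (strCode w) / (optUnits (strCode w)).gcd (commonDen (strCode w))) ++
    encodeNat (commonDen (strCode w) / (optUnits (strCode w)).gcd (commonDen (strCode w)))

theorem inFPNP_optConfString : InFPNP optConfString := by
  have hU : PT valueOracle optUnits := PT.bsearch (by fun_prop) (by fun_prop)
  -- The innermost 1 is the code of the empty string, to which the two numbers are prepended.
  have hf : PT valueOracle fun p : ℕ × ℕ => writeNat (optUnits p.1 / (optUnits p.1).gcd
      (commonDen p.1)) (writeNat (commonDen p.1 / (optUnits p.1).gcd (commonDen p.1)) 1) := by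
    have hU' : PT valueOracle fun p : ℕ × ℕ => optUnits p.1 := hU.comp PT.fst
    fun_prop
  obtain ⟨P, q, hP⟩ := exists_prog_of_pt hf
  refine ⟨valueOracle, q.comp (.X + 1), P, inNP_valueOracle, fun x => ?_⟩
  obtain ⟨c, s, e, hc, h⟩ := hP (strCode x) 0
  refine ⟨c, s, e, hc.trans_eq ?_, h.trans ?_⟩
  · simp [size_strCode, Polynomial.eval_comp]
  · change writeNat _ (writeNat _ (strCode [])) = _
    rw [writeNat_strCode, writeNat_strCode, List.append_nil]
    rfl

theorem oracleAnswer_ne_zero {A : Language Bool} {w : List Bool} :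
    oracleAnswer A (strCode w) ≠ 0 ↔ w ∈ A := by
  have : (∃ v ∈ A, strCode v = strCode w) ↔ w ∈ A :=
    ⟨fun ⟨v, hv, h⟩ => strCode_injective h ▸ hv, fun h => ⟨w, h, rfl⟩⟩
  simp [oracleAnswer, this]

/-- The certificate need not be bounded on the right: from any `y` pass to an interpretation that is
at least as good, and from there to a string of best choices, which is short. -/
theorem oracleAnswer_writeNat (φ : NNF) (z : ℕ) :
    oracleAnswer valueOracle (writeNat z (strCode (encodeNNF φ))) ≠ 0 ↔
      ∃ y : ℕ, z * (selValue (strCode (encodeNNF φ)) y).2 ≤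
        (selValue (strCode (encodeNNF φ)) y).1 * commonDen (strCode (encodeNNF φ)) := by
  rw [writeNat_strCode, oracleAnswer_ne_zero]
  have hv : ∀ y, verify (strCode (encodeNat z ++ encodeNNF φ)) y = 1 ↔
      z * (selValue (strCode (encodeNNF φ)) y).2 ≤
        (selValue (strCode (encodeNNF φ)) y).1 * commonDen (strCode (encodeNNF φ)) := by
    intro y
    rw [verify, readNat_strCode]
    simp
  constructor
  · rintro ⟨y, -, h⟩
    exact ⟨_, (hv _).1 h⟩
  · rintro ⟨y, h⟩
    obtain ⟨π, hπ⟩ := exists_conf_ge φ y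
    obtain ⟨u, hu, hu'⟩ := exists_choices_ge φ π
    refine ⟨u, by rw [List.length_append]; omega, (hv _).2 ?_⟩
    have hD : (0 : ℝ) < (selValue (strCode (encodeNNF φ)) y).2 :=
      Nat.cast_pos.2 (selValue_den_pos φ y)
    have hD' : (0 : ℝ) ≤ (selValue (strCode (encodeNNF φ)) (strCode u)).2 := Nat.cast_nonneg _
    have h' : (z : ℝ) * (selValue (strCode (encodeNNF φ)) y).2 ≤
        (selValue (strCode (encodeNNF φ)) y).1 * commonDen (strCode (encodeNNF φ)) := by
      exact_mod_cast h
    have hC : (0 : ℝ) ≤ commonDen (strCode (encodeNNF φ)) := Nat.cast_nonneg _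
    have hz : (z : ℝ) ≤ (Conf φ π).val * commonDen (strCode (encodeNNF φ)) := by
      refine le_of_mul_le_mul_right ?_ hD
      calc _ ≤ _ := h'
        _ ≤ _ := mul_le_mul_of_nonneg_right hπ hC
        _ = _ := by ring
    have : (z : ℝ) * (selValue (strCode (encodeNNF φ)) (strCode u)).2 ≤
        (selValue (strCode (encodeNNF φ)) (strCode u)).1 *
          commonDen (strCode (encodeNNF φ)) := by
      calc _ ≤ _ := mul_le_mul_of_nonneg_right hz hD'
        _ = (Conf φ π).val * (selValue (strCode (encodeNNF φ)) (strCode u)).2 *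
          commonDen (strCode (encodeNNF φ)) := by ring
        _ ≤ _ := mul_le_mul_of_nonneg_right hu' hC
    exact_mod_cast this

theorem commonDen_pos (x : ℕ) : 0 < commonDen x := pow_pos (Nat.factorial_pos _) _

theorem selValue_num_le (φ : NNF) (y : ℕ) :
    (selValue (strCode (encodeNNF φ)) y).1 ≤ (selValue (strCode (encodeNNF φ)) y).2 := by
  obtain ⟨π, hπ⟩ := exists_conf_ge φ y
  have h := mul_le_mul_of_nonneg_right (Viterbi.val_le_one (Conf φ π))
    (Nat.cast_nonneg (selValue (strCode (encodeNNF φ)) y).2 : (0 : ℝ) ≤ _)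
  rw [one_mul] at h
  exact_mod_cast hπ.trans h

/-- In units of the common denominator, every value of a selection is an integer. -/
theorem exists_selValue_units (φ : NNF) (y : ℕ) : ∃ k, 0 < k ∧
    commonDen (strCode (encodeNNF φ)) = (selValue (strCode (encodeNNF φ)) y).2 * k := by
  obtain ⟨k, hk⟩ := selValue_den_dvd φ y
  refine ⟨k, Nat.pos_of_ne_zero ?_, hk⟩
  rintro rfl
  exact (commonDen_pos (strCode (encodeNNF φ))).ne' hk

/-- The search finds the optimum itself and not an approximation, because every value is an integer
in units of the common denominator. -/
theorem optUnits_spec (φ : NNF) :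
    (∃ y, optUnits (strCode (encodeNNF φ)) * (selValue (strCode (encodeNNF φ)) y).2 =
      (selValue (strCode (encodeNNF φ)) y).1 * commonDen (strCode (encodeNNF φ))) ∧
    ∀ y, (selValue (strCode (encodeNNF φ)) y).1 * commonDen (strCode (encodeNNF φ)) ≤
      optUnits (strCode (encodeNNF φ)) * (selValue (strCode (encodeNNF φ)) y).2 := by
  obtain ⟨h₁, h₂⟩ := bsearch_spec
    (c := fun z => oracleAnswer valueOracle (writeNat z (strCode (encodeNNF φ))))
    (U := commonDen (strCode (encodeNNF φ)))
    ((oracleAnswer_writeNat φ 0).2 ⟨0, by simp⟩)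
    -- Values are at most 1, so no `z` above the common denominator passes the test.
    (fun z hz => by
      obtain ⟨y, hy⟩ := (oracleAnswer_writeNat φ z).1 hz
      have := Nat.mul_le_mul_right (commonDen (strCode (encodeNNF φ))) (selValue_num_le φ y)
      rw [mul_comm (selValue (strCode (encodeNNF φ)) y).2] at this
      exact Nat.le_of_mul_le_mul_right (hy.trans this) (selValue_den_pos φ y))
    (fun y z hyz hz => by
      obtain ⟨u, hu⟩ := (oracleAnswer_writeNat φ z).1 hz
      exact (oracleAnswer_writeNat φ y).2 ⟨u, (Nat.mul_le_mul_right _ hyz).trans hu⟩)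
  have hmax : ∀ y, (selValue (strCode (encodeNNF φ)) y).1 * commonDen (strCode (encodeNNF φ)) ≤
      optUnits (strCode (encodeNNF φ)) * (selValue (strCode (encodeNNF φ)) y).2 := by
    intro y
    obtain ⟨k, -, hk⟩ := exists_selValue_units φ y
    -- The value of the selection `y` in units of the common denominator is its numerator times `k`.
    have h := h₂ ((selValue (strCode (encodeNNF φ)) y).1 * k)
      ((oracleAnswer_writeNat φ _).2 ⟨y, by rw [hk]; apply le_of_eq; ring⟩)
    calc _ = (selValue (strCode (encodeNNF φ)) y).1 * k *
          (selValue (strCode (encodeNNF φ)) y).2 := by rw [hk]; ring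
      _ ≤ _ := Nat.mul_le_mul_right _ h
  obtain ⟨y, hy⟩ := (oracleAnswer_writeNat φ _).1 h₁
  exact ⟨⟨y, le_antisymm hy (hmax y)⟩, hmax⟩

theorem exists_isOptConfVal (φ : NNF) : ∃ v : Viterbi, IsOptConfVal φ v ∧
    v.val * commonDen (strCode (encodeNNF φ)) = optUnits (strCode (encodeNNF φ)) := by
  obtain ⟨⟨y, hy⟩, hmax⟩ := optUnits_spec φ
  have hC : (0 : ℝ) < commonDen (strCode (encodeNNF φ)) := Nat.cast_pos.2 (commonDen_pos _)
  have hle : ∀ π, (Conf φ π).val * commonDen (strCode (encodeNNF φ)) ≤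
      optUnits (strCode (encodeNNF φ)) := by
    intro π
    obtain ⟨u, -, hu⟩ := exists_choices_ge φ π
    have hD : (0 : ℝ) < (selValue (strCode (encodeNNF φ)) (strCode u)).2 :=
      Nat.cast_pos.2 (selValue_den_pos φ _)
    refine le_of_mul_le_mul_right ?_ hD
    calc _ = (Conf φ π).val * (selValue (strCode (encodeNNF φ)) (strCode u)).2 *
          commonDen (strCode (encodeNNF φ)) := by ring
      _ ≤ _ := mul_le_mul_of_nonneg_right hu hC.le
      _ ≤ _ := by exact_mod_cast hmax (strCode u)
  obtain ⟨π, hπ⟩ := exists_conf_ge φ y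
  have hge : (optUnits (strCode (encodeNNF φ)) : ℝ) ≤
      (Conf φ π).val * commonDen (strCode (encodeNNF φ)) := by
    have hD : (0 : ℝ) < (selValue (strCode (encodeNNF φ)) y).2 :=
      Nat.cast_pos.2 (selValue_den_pos φ _)
    refine le_of_mul_le_mul_right ?_ hD
    calc _ = ((selValue (strCode (encodeNNF φ)) y).1 * commonDen (strCode (encodeNNF φ)) : ℝ) := by
          exact_mod_cast hy
      _ ≤ _ := mul_le_mul_of_nonneg_right hπ hC.le
      _ = _ := by ring
  refine ⟨Conf φ π, ⟨⟨π, rfl⟩, ?_⟩, le_antisymm (hle π) hge⟩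
  rintro _ ⟨π', rfl⟩
  have : (Conf φ π').val ≤ (Conf φ π).val :=
    le_of_mul_le_mul_right ((hle π').trans hge) hC
  exact this

/-- By coprimality, `n` and `d` are `q.num` and `q.den` multiplied by the same `k`, which is
therefore their gcd. -/
theorem num_den_of_mul_eq {q : ℚ≥0} {n d : ℕ} (hd : 0 < d) (h : q * d = n) :
    q.num = n / n.gcd d ∧ q.den = d / n.gcd d := by
  have hg : 0 < n.gcd d := Nat.gcd_pos_of_pos_right _ hd
  have e : q.num * d = n * q.den := by
    have := congrArg (· * (q.den : ℚ≥0)) h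
    rw [mul_right_comm, NNRat.mul_den_eq_num] at this
    exact_mod_cast this
  obtain ⟨k, hk⟩ : q.den ∣ d :=
    q.coprime_num_den.symm.dvd_of_dvd_mul_left ⟨n, by rw [e, mul_comm]⟩
  have hk0 : 0 < k := by
    rcases Nat.eq_zero_or_pos k with rfl | hk'
    · simp [hk] at hd
    · exact hk'
  have hn : n = q.num * k := by
    refine Nat.eq_of_mul_eq_mul_right q.den_pos ?_
    rw [← e, hk]
    ring
  have hgcd : n.gcd d = k := by
    rw [hn, hk, Nat.gcd_mul_right, q.coprime_num_den, one_mul]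
  rw [hgcd]
  constructor
  · rw [hn, Nat.mul_div_cancel _ hk0]
  · exact (Nat.div_eq_of_eq_mul_left hk0 hk).symm

theorem den_le_of_mul_eq {q : ℚ≥0} {n d : ℕ} (hd : 0 < d) (h : q * d = n) : q.den ≤ d := by
  rw [(num_den_of_mul_eq hd h).2]
  exact Nat.div_le_self _ _

end ConfOpt

/-! ### The main theorem -/

theorem mainTheorem2 :
    ∃ f : List Bool → List Bool, ConfOpt.InFPNP f ∧
      ∀ φ : ConfOpt.NNF, ∃ (v : ConfOpt.Viterbi) (q : ℚ≥0),
        ConfOpt.IsOptConfVal φ v ∧ v.val = (q : ℝ) ∧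
        q.den ≤ φ.size ^ (φ.vars.card * φ.size) ∧
        f (ConfOpt.encodeNNF φ) = ConfOpt.encodeNNRat q := by
  refine ⟨ConfOpt.optConfString, ConfOpt.inFPNP_optConfString, fun φ => ?_⟩
  obtain ⟨v, hv, h⟩ := ConfOpt.exists_isOptConfVal φ
  obtain ⟨⟨y, hy⟩, -⟩ := ConfOpt.optUnits_spec φ
  have hC := ConfOpt.commonDen_pos (ConfOpt.strCode (ConfOpt.encodeNNF φ))
  have hD := ConfOpt.selValue_den_pos φ y
  have hden := ConfOpt.selValue_den_le φ y
  -- The optimum is used as two fractions: over the common denominator it yields the output, over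
  -- the denominator of the optimal selection `y` it yields the bound.
  let q : ℚ≥0 := ConfOpt.optUnits (ConfOpt.strCode (ConfOpt.encodeNNF φ)) /
    ConfOpt.commonDen (ConfOpt.strCode (ConfOpt.encodeNNF φ))
  have hC' : (ConfOpt.commonDen (ConfOpt.strCode (ConfOpt.encodeNNF φ)) : ℚ≥0) ≠ 0 :=
    Nat.cast_ne_zero.2 hC.ne'
  have hq : q * ConfOpt.commonDen (ConfOpt.strCode (ConfOpt.encodeNNF φ)) =
      ConfOpt.optUnits (ConfOpt.strCode (ConfOpt.encodeNNF φ)) := div_mul_cancel₀ _ hC'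
  refine ⟨v, q, hv, ?_, ?_, ?_⟩
  · have hC'' : (ConfOpt.commonDen (ConfOpt.strCode (ConfOpt.encodeNNF φ)) : ℝ) ≠ 0 :=
      Nat.cast_ne_zero.2 hC.ne'
    refine mul_right_cancel₀ hC'' (h.trans ?_)
    exact_mod_cast congrArg (NNRat.cast : ℚ≥0 → ℝ) hq.symm
  · refine (ConfOpt.den_le_of_mul_eq hD (n := (ConfOpt.selValue (ConfOpt.strCode
      (ConfOpt.encodeNNF φ)) y).1) (mul_right_cancel₀ hC' ?_)).trans hden
    rw [mul_right_comm, hq]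
    exact_mod_cast hy
  · obtain ⟨h₁, h₂⟩ := ConfOpt.num_den_of_mul_eq hC hq
    rw [ConfOpt.encodeNNRat, h₁, h₂, ConfOpt.optConfString]
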